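/- **Parsings.** Let ${\bf s}=s_1\cdots s_N$ be a finite string. A *parsing* of ${\bf s}$ of *size* $t$ is given by indices $0=i_0<i_1<\dots<i_t=N$; its $j$-th *phrase* is ${\bf s}[i_{j-1}+1,i_j]$. It is an *LZ-parsing* if each phrase either is a single character or comes with a chosen starting position $a_j\le i_{j-1}$ such that its longest proper prefix also occurs in ${\bf s}$ at position $a_j$, i.e. ${\bf s}[a_j,\,a_j+(i_j-i_{j-1})-2]={\bf s}[i_{j-1}+1,\,i_j-1]$ (the two occurrences may overlap). For $1\le r<i_j-i_{j-1}$, the *source* of the position $p=i_{j-1}+r$ is the position $a_j+\big((r-1)\bmod(i_{j-1}+1-a_j)\big)$ (which is $a_j+r-1$ if the two occurrences do not overlap). The *hop-number* of a position is $0$ if it is the last position of a phrase, and otherwise $1$ plus the hop-number of its source. A *$c$-BLZ parsing* is an LZ-parsing (with chosen sources) in which every position has hop-number at most $c$. **The string ${\bf s}_G$.** Let $G=(V,E)$ be a finite simple undirected graph with vertices $v_1,\dots,v_n$ and edges $e_1,\dots,e_m$, enumerated in any order and with the two endpoints of every edge written in any order. Let $\ell$ be a positive integer. Over an alphabet consisting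 of pairwise distinct letters $v_i,v_i',\#^v_i$ ($1\le i\le n$), $e_j,\$_j,\#^e_j$ ($1\le j\le m$), $\#^p_i$ ($1\le i\le n+m$) and $\#^{(i)}_\gamma$ ($i\ge1$, $1\le\gamma\le\ell$), put $$P=v_1\#^p_1\cdots v_n\#^p_n\;e_1\#^p_{n+1}\cdots e_m\#^p_{n+m},\qquad X=X_1\cdots X_n,\quad X_i=v_i'\,v_i\,\#^v_i,$$ $$Y=Y_1\cdots Y_m,\qquad Y_j=v_p'\,v_p\,e_j\,\$_j\,v_q'\,v_q\,e_j\,\$_j\,\#^e_j\quad\text{for } e_j=(v_p,v_q),$$ $$\alpha^{(1)}=PXY,\qquad \beta^{(i)}=\alpha^{(i)}\#^{(i)}_1\,\alpha^{(i)}\#^{(i)}_2\cdots\alpha^{(i)}\#^{(i)}_\ell,\qquad \alpha^{(i+1)}=\alpha^{(i)}\beta^{(i)}\quad(i\ge1).$$ **Theorem.** Let $G$ be a finite simple undirected graph with $n$ vertices and $m$ edges, and let $c\ge1$, $0\le k\le n$ and $\ell>k$ be integers. Let ${\bf s}_G=\alpha^{(c)}$ be the string constructed above from $G$ and $\ell$.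 Then $G$ has a vertex cover of size $k$ (a set of exactly $k$ vertices meeting every edge) if and only if ${\bf s}_G$ has a $c$-BLZ parsing of size exactly $4n+6m+k+\ell(c-1)$. -/

import Mathlib

/-! Positions of a string are counted from `0`: the string `s` has the positions `0, …, |s| - 1`. -/

/-- An LZ-parsing of `s` together with the chosen sources. There are `size` phrases; phrase `j`
occupies the positions `cut j, …, cut (j + 1) - 1`. If it has more than one character, then its
longest proper prefix also occurs at the earlier position `src j` (the two occurrences may
overlap). For a phrase of one character the value of `src` is irrelevant. -/
structure LZParsing {A : Type*} (s : List A) where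
  size : ℕ
  cut : Fin (size + 1) → ℕ
  cut_strictMono : StrictMono cut
  cut_zero : cut 0 = 0
  cut_last : cut (Fin.last size) = s.length
  src : Fin size → ℕ
  isLZ : ∀ j : Fin size, cut j.succ = cut j.castSucc + 1 ∨
    (src j < cut j.castSucc ∧
      ∀ r : ℕ, cut j.castSucc + r + 1 < cut j.succ → s[src j + r]? = s[cut j.castSucc + r]?)

namespace LZParsing

variable {A : Type*} {s : List A}

/-- Position `p` lies in phrase `j` and is not its last position. -/
def InPrefix (φ : LZParsing s) (p : ℕ) (j : Fin φ.size) : Prop :=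
  φ.cut j.castSucc ≤ p ∧ p + 1 < φ.cut j.succ

/-- The source of the position `p` of phrase `j`. If the source of the phrase does not overlap
the phrase, the remainder is `p - cut j` itself and this is the corresponding position of the
source. If it does, the phrase is a power of `s[src j], …, s[cut j - 1]`, and this is the
corresponding position in that repeated string. -/
def sourcePos (φ : LZParsing s) (p : ℕ) (j : Fin φ.size) : ℕ :=
  φ.src j + (p - φ.cut j.castSucc) % (φ.cut j.castSucc - φ.src j)

theorem sourcePos_lt (φ : LZParsing s) {p : ℕ} {j : Fin φ.size} (h : φ.InPrefix p j) :
    φ.sourcePos p j < p := by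
  obtain ⟨h1, h2⟩ := h
  rcases φ.isLZ j with h3 | ⟨h3, -⟩
  · omega
  · have := Nat.mod_lt (p - φ.cut j.castSucc) (Nat.sub_pos_of_lt h3)
    unfold sourcePos
    omega

open Classical in
/-- The hop-number of a position: `0` at the last position of a phrase, and one more than the
hop-number of its source at every other position. -/
noncomputable def hop (φ : LZParsing s) (p : ℕ) : ℕ :=
  if h : ∃ j, φ.InPrefix p j then hop φ (φ.sourcePos p h.choose) + 1 else 0
termination_by p
decreasing_by exact φ.sourcePos_lt h.choose_spec

theorem inPrefix_unique (φ : LZParsing s) {p : ℕ} {i j : Fin φ.size}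
    (hi : φ.InPrefix p i) (hj : φ.InPrefix p j) : i = j := by
  obtain ⟨a1, a2⟩ := hi
  obtain ⟨b1, b2⟩ := hj
  rcases lt_trichotomy i j with h | h | h
  · have := φ.cut_strictMono.monotone (show i.succ ≤ j.castSucc from h)
    omega
  · exact h
  · have := φ.cut_strictMono.monotone (show j.succ ≤ i.castSucc from h)
    omega

theorem hop_of_inPrefix (φ : LZParsing s) {p : ℕ} {j : Fin φ.size} (h : φ.InPrefix p j) :
    φ.hop p = φ.hop (φ.sourcePos p j) + 1 := by
  have h' : ∃ j, φ.InPrefix p j := ⟨j, h⟩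
  rw [hop, dif_pos h', φ.inPrefix_unique h'.choose_spec h]

theorem hop_of_last (φ : LZParsing s) {p : ℕ} {j : Fin φ.size} (h : p + 1 = φ.cut j.succ) :
    φ.hop p = 0 := by
  rw [hop, dif_neg]
  rintro ⟨i, h1, h2⟩
  rcases lt_trichotomy i j with h' | rfl | h'
  · have := φ.cut_strictMono.monotone (Fin.succ_le_succ_iff.mpr h'.le)
    omega
  · omega
  · have := φ.cut_strictMono.monotone (show j.succ ≤ i.castSucc from h')
    omega

/-- The largest hop-number of a position of `s` (`0` for the empty string). -/
noncomputable def hopMax (φ : LZParsing s) : ℕ :=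
  (Finset.range s.length).sup φ.hop

/-- The parsing is a `c`-BLZ parsing. -/
def IsBLZ (φ : LZParsing s) (c : ℕ) : Prop :=
  φ.hopMax ≤ c

end LZParsing

/-- The letters of the constructed strings; different terms are different letters.
`vert i`, `vert' i`, `edge j`, `dollar j` are `v_i`, `v_i'`, `e_j`, `$_j`; the separators
`sepP`, `sepV`, `sepE` are `#^p`, `#^v`, `#^e`, and `sepB i γ` is `#^(i)_γ`. -/
inductive Letter (n m ℓ : ℕ) where
  | vert (i : Fin n)
  | vert' (i : Fin n)
  | edge (j : Fin m)
  | dollar (j : Fin m)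
  | sepP (i : Fin (n + m))
  | sepV (i : Fin n)
  | sepE (j : Fin m)
  | sepB (i : ℕ) (γ : Fin ℓ)

/-- An enumeration `v_1, …, v_n` of the vertices and `e_1, …, e_m` of the edges of `G`, with the
two endpoints of each edge `e_j` written in some order: `e_j = (v_p, v_q)` for `p = fst j` and
`q = snd j`. -/
structure GraphNumbering {V : Type*} (G : SimpleGraph V) (n m : ℕ) where
  vert : Fin n ≃ V
  edge : Fin m ≃ G.edgeSet
  fst : Fin m → Fin n
  snd : Fin m → Fin n
  edge_eq : ∀ j, (edge j : Sym2 V) = s(vert (fst j), vert (snd j))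

namespace GraphNumbering

variable {V : Type*} {G : SimpleGraph V} {n m : ℕ}

theorem exists_numbering [Finite V] (hn : Nat.card V = n) (hm : Nat.card G.edgeSet = m) :
    Nonempty (GraphNumbering G n m) := by
  let v : Fin n ≃ V := (Finite.equivFinOfCardEq hn).symm
  let e : Fin m ≃ G.edgeSet := (Finite.equivFinOfCardEq hm).symm
  have h : ∀ j, ∃ p : Fin n × Fin n, (e j : Sym2 V) = s(v p.1, v p.2) := by
    intro j
    obtain ⟨⟨a, b⟩, hab⟩ := Quot.exists_rep (e j : Sym2 V)
    exact ⟨(v.symm a, v.symm b), by simpa using hab.symm⟩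
  choose f hf using h
  exact ⟨⟨v, e, fun j => (f j).1, fun j => (f j).2, hf⟩⟩

/-- `P = v_1 #^p_1 … v_n #^p_n e_1 #^p_{n+1} … e_m #^p_{n+m}`. -/
def strP (n m ℓ : ℕ) : List (Letter n m ℓ) :=
  (List.finRange n).flatMap (fun i => [.vert i, .sepP (Fin.castAdd m i)]) ++
    (List.finRange m).flatMap (fun j => [.edge j, .sepP (Fin.natAdd n j)])

/-- `X = X_1 … X_n` with `X_i = v_i' v_i #^v_i`. -/
def strX (n m ℓ : ℕ) : List (Letter n m ℓ) :=
  (List.finRange n).flatMap (fun i => [.vert' i, .vert i, .sepV i])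

/-- `Y = Y_1 … Y_m` with `Y_j = v_p' v_p e_j $_j v_q' v_q e_j $_j #^e_j` for `e_j = (v_p, v_q)`. -/
def strY (N : GraphNumbering G n m) (ℓ : ℕ) : List (Letter n m ℓ) :=
  (List.finRange m).flatMap (fun j =>
    [.vert' (N.fst j), .vert (N.fst j), .edge j, .dollar j,
     .vert' (N.snd j), .vert (N.snd j), .edge j, .dollar j, .sepE j])

/-- `β^(i) = a #^(i)_1 a #^(i)_2 … a #^(i)_ℓ`, where `a` stands for `α^(i)`. -/
def strBeta {n m ℓ : ℕ} (i : ℕ) (a : List (Letter n m ℓ)) : List (Letter n m ℓ) :=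
  (List.finRange ℓ).flatMap (fun γ => a ++ [.sepB i γ])

/-- `α^(1) = P X Y` and `α^(i) = α^(i-1) β^(i-1)` for `i > 1` (the value at `i = 0` is not used). -/
def strAlpha (N : GraphNumbering G n m) (ℓ : ℕ) : ℕ → List (Letter n m ℓ)
  | 0 => []
  | 1 => strP n m ℓ ++ strX n m ℓ ++ N.strY ℓ
  | i + 2 => N.strAlpha ℓ (i + 1) ++ strBeta (i + 1) (N.strAlpha ℓ (i + 1))

end GraphNumbering

/-!
The size of a parsing is the number of its phrase ends, and a first occurrence of a letter is
always a phrase end.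

*From a cover to a parsing.* In `P` every letter is a phrase; `X_i` is parsed as `v_i' | v_i | #` if
`v_i` is in the cover and as `v_i' | v_i #` otherwise. Each `Y_j` takes four phrases: for an
endpoint `v` of `e_j` in the cover, its half starts with the phrase `v' v e_j`, since both letters
of `v' v` are phrase ends in `X`; the other half starts with `v' v` alone, and its `e_j $_j` is
copied from phrase ends of the half of `v`, or, if it comes first, its `e_j` is copied from `P`.
Each of the copies of `α^(i)` in `β^(i)` is one phrase copied from the prefix `α^(i)`, which raises
the hop-numbers by one (`hasParsing_hopAlpha`).

*From a parsing to a cover.* The first copy of `α^(1)` contains at least `4n + 6m` phrase ends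
(`forced_ends`, `Tag.Forced.card_le`), and the first occurrences of the separators `#^(i)_γ` are
`ℓ (c - 1)` others. So at most `k` phrase ends, less than `ℓ`, are not forced. If `α^(i + 1)` occurs
with hop-numbers at most `i + 1`, then one of the `ℓ` blocks `α^(i)` in this occurrence contains no
phrase end, and so it is copied within one phrase. Its sources form an occurrence of `α^(i)` with
hop-numbers at most `i`: sources that wrap around would produce a square whose middle is strictly
inside an occurrence of `α^(i)`, but the squares of large period are the occurrences of
`α^(j) α^(j)` (`square_strAlpha`) and occurrences of `α^(i)` do not overlap (`not_overlap`).
Descending from `α^(c)`, some copy of `α^(1)` has hop-numbers at most one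
(`exists_occursAt_hop_le_one`).

For each position of `α^(1)`, ask whether a phrase ends there in *some* copy of `α^(1)` in the
string (`Tag.offsets`). These positions are still at most `4n + 6m + k` in number. The vertices
`v_i` for which the `v_i` of `X_i` is such a position, together with one endpoint of `e_j` for each
such position of `Y_j` beyond the four forced ones, number at most `k` (`coverOf`). They form a
cover: if `Y_j` has only four such positions, then in the copy with hop-numbers at most one, some
`v' v` of `Y_j` is copied from phrase ends, which puts the endpoint `v` into the set
(`fst_or_snd_mem_coverOf`).
-/

/-! ### Phrase ends, sources and periods -/

namespace LZParsing

variable {A : Type*} {s : List A}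

theorem exists_phrase (φ : LZParsing s) {p : ℕ} (hp : p < s.length) :
    ∃ j : Fin φ.size, φ.cut j.castSucc ≤ p ∧ p < φ.cut j.succ := by
  by_contra! h
  have key : ∀ i : Fin (φ.size + 1), φ.cut i ≤ p := by
    intro i
    induction i using Fin.induction with
    | zero => rw [φ.cut_zero]; exact Nat.zero_le p
    | succ i ih => exact h i ih
  have := key (Fin.last φ.size)
  rw [φ.cut_last] at this
  omega

theorem cut_le_length (φ : LZParsing s) (i : Fin (φ.size + 1)) : φ.cut i ≤ s.length := by
  rw [← φ.cut_last]
  exact φ.cut_strictMono.monotone (Fin.le_last i)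

theorem cut_castSucc_lt (φ : LZParsing s) (j : Fin φ.size) :
    φ.cut j.castSucc < φ.cut j.succ :=
  φ.cut_strictMono Fin.castSucc_lt_succ

/-- The set of the last positions of the phrases. -/
def ends (φ : LZParsing s) : Finset ℕ :=
  Finset.univ.image fun j : Fin φ.size => φ.cut j.succ - 1

theorem mem_ends (φ : LZParsing s) {p : ℕ} :
    p ∈ φ.ends ↔ ∃ j : Fin φ.size, p + 1 = φ.cut j.succ := by
  simp only [ends, Finset.mem_image, Finset.mem_univ, true_and]
  refine exists_congr fun j => ?_
  have := φ.cut_castSucc_lt j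
  omega

theorem card_ends (φ : LZParsing s) : φ.ends.card = φ.size := by
  rw [ends, Finset.card_image_of_injective, Finset.card_univ, Fintype.card_fin]
  intro i j h
  have h1 := φ.cut_castSucc_lt i
  have h2 := φ.cut_castSucc_lt j
  have h3 : φ.cut i.succ = φ.cut j.succ := by simp only at h; omega
  exact Fin.succ_injective _ (φ.cut_strictMono.injective h3)

theorem exists_inPrefix (φ : LZParsing s) {p : ℕ} (hp : p < s.length) (h : p ∉ φ.ends) :
    ∃ j, φ.InPrefix p j := by
  obtain ⟨j, h1, h2⟩ := φ.exists_phrase hp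
  refine ⟨j, h1, ?_⟩
  have : p + 1 ≠ φ.cut j.succ := fun h3 => h (φ.mem_ends.2 ⟨j, h3⟩)
  omega

theorem mem_ends_of_hop_eq_zero (φ : LZParsing s) {p : ℕ} (hp : p < s.length)
    (h : φ.hop p = 0) : p ∈ φ.ends := by
  by_contra h1
  obtain ⟨j, hj⟩ := φ.exists_inPrefix hp h1
  rw [φ.hop_of_inPrefix hj] at h
  omega

theorem hop_le (φ : LZParsing s) {c p : ℕ} (h : φ.IsBLZ c) (hp : p < s.length) :
    φ.hop p ≤ c :=
  (Finset.le_sup (f := φ.hop) (Finset.mem_range.2 hp)).trans h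

/-- An interval without phrase ends lies in the proper prefix of a single phrase. -/
theorem exists_forall_inPrefix (φ : LZParsing s) {y L : ℕ} (hL : 0 < L)
    (hy : y + L ≤ s.length) (h : ∀ r < L, y + r ∉ φ.ends) :
    ∃ j, ∀ r < L, φ.InPrefix (y + r) j := by
  obtain ⟨j, h1, h2⟩ := φ.exists_inPrefix (p := y) (by omega) (h 0 hL)
  refine ⟨j, fun r hr => ⟨by omega, ?_⟩⟩
  by_contra h3
  refine h (φ.cut j.succ - 1 - y) (by omega) (φ.mem_ends.2 ⟨j, by omega⟩)

theorem src_lt_of_inPrefix (φ : LZParsing s) {p : ℕ} {j : Fin φ.size} (h : φ.InPrefix p j) :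
    φ.src j < φ.cut j.castSucc := by
  obtain ⟨h1, h2⟩ := h
  rcases φ.isLZ j with h3 | h3
  · omega
  · exact h3.1

/-- From the source of a phrase to the end of its proper prefix, the string has the distance from
source to phrase as a period. -/
theorem getElem?_period (φ : LZParsing s) {j : Fin φ.size} {q : ℕ} (hq : φ.src j ≤ q)
    (h : φ.InPrefix (q + (φ.cut j.castSucc - φ.src j)) j) :
    s[q]? = s[q + (φ.cut j.castSucc - φ.src j)]? := by
  have h0 := φ.src_lt_of_inPrefix h
  obtain ⟨h1, h2⟩ := h
  rcases φ.isLZ j with h3 | ⟨-, h3⟩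
  · omega
  · have := h3 (q - φ.src j) (by omega)
    convert this using 2 <;> omega

theorem getElem?_period_mul (φ : LZParsing s) {j : Fin φ.size} {q : ℕ} (hq : φ.src j ≤ q)
    (k : ℕ) (h : φ.InPrefix (q + k * (φ.cut j.castSucc - φ.src j)) j) :
    s[q]? = s[q + k * (φ.cut j.castSucc - φ.src j)]? := by
  induction k with
  | zero => simp
  | succ k ih =>
    rw [Nat.succ_mul, ← add_assoc] at h ⊢
    rcases Nat.lt_or_ge (q + k * (φ.cut j.castSucc - φ.src j)) (φ.cut j.castSucc) with h1 | h1
    · -- below the phrase only `k = 0` is possible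
      have hk : k = 0 := by
        have h0 := φ.src_lt_of_inPrefix h
        by_contra hk
        have := Nat.le_mul_of_pos_left (φ.cut j.castSucc - φ.src j) (Nat.pos_of_ne_zero hk)
        omega
      subst hk
      simp only [zero_mul, add_zero] at h ⊢
      exact φ.getElem?_period hq h
    · rw [ih ⟨h1, by have := h.2; omega⟩]
      exact φ.getElem?_period (by omega) h

/-- The text that follows the source of `p` agrees with the text that follows `p` up to the end of
the proper prefix of the phrase, also where the sources of these positions wrap around. -/
theorem getElem?_sourcePos_add (φ : LZParsing s) {p r : ℕ} {j : Fin φ.size}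
    (h : φ.InPrefix p j) (h' : φ.InPrefix (p + r) j) :
    s[φ.sourcePos p j + r]? = s[p + r]? := by
  have h0 := φ.src_lt_of_inPrefix h
  have e : p + r = φ.sourcePos p j + r +
      ((p - φ.cut j.castSucc) / (φ.cut j.castSucc - φ.src j) + 1) *
        (φ.cut j.castSucc - φ.src j) := by
    have h1 := Nat.mod_add_div (p - φ.cut j.castSucc) (φ.cut j.castSucc - φ.src j)
    rw [mul_comm] at h1
    rw [Nat.succ_mul, sourcePos]
    have := h.1
    omega
  have h2 := φ.getElem?_period_mul (j := j) (q := φ.sourcePos p j + r)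
    (by unfold sourcePos; omega) _ (by rw [← e]; exact h')
  rw [← e] at h2
  exact h2

theorem getElem?_sourcePos (φ : LZParsing s) {p : ℕ} {j : Fin φ.size} (h : φ.InPrefix p j) :
    s[φ.sourcePos p j]? = s[p]? := by
  simpa using φ.getElem?_sourcePos_add (r := 0) h (by simpa using h)

/-- The first occurrence of a letter is the end of a phrase. -/
theorem mem_ends_of_first (φ : LZParsing s) {p : ℕ} (hp : p < s.length)
    (h : ∀ u < p, s[u]? ≠ s[p]?) : p ∈ φ.ends := by
  by_contra h1
  obtain ⟨j, hj⟩ := φ.exists_inPrefix hp h1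
  exact h _ (φ.sourcePos_lt hj) (φ.getElem?_sourcePos hj)

/-- Consecutive positions `p`, `p + 1` of a proper prefix have consecutive sources, unless
`p + 1` is congruent to the start of the phrase modulo its period; then the sources are the
position before the phrase and the start of the source of the phrase. -/
theorem sourcePos_succ (φ : LZParsing s) {p : ℕ} {j : Fin φ.size} (h : φ.InPrefix p j) :
    φ.sourcePos (p + 1) j = φ.sourcePos p j + 1 ∨
      (φ.sourcePos (p + 1) j = φ.src j ∧ φ.sourcePos p j + 1 = φ.cut j.castSucc) := by
  have h0 := φ.src_lt_of_inPrefix h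
  unfold sourcePos
  rw [show p + 1 - φ.cut j.castSucc = (p - φ.cut j.castSucc) + 1 by have := h.1; omega]
  have h1 := Nat.mod_lt (p - φ.cut j.castSucc) (Nat.sub_pos_of_lt h0)
  rw [Nat.add_mod_eq_ite]
  rcases Nat.lt_or_ge 1 (φ.cut j.castSucc - φ.src j) with h2 | h2
  · rw [Nat.mod_eq_of_lt h2]
    split_ifs <;> omega
  · have h3 : φ.cut j.castSucc - φ.src j = 1 := by omega
    simp only [h3, Nat.mod_one, Nat.mod_self]
    right
    simp only [add_zero]
    split_ifs <;> omega

end LZParsing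

/-! ### Tagged strings -/

/-- The blocks of `α^(1)`: the two kinds of pairs in `P`, the blocks `X_i` and the blocks `Y_j`. -/
inductive Block (n m : ℕ) where
  | pVert (i : Fin n)
  | pEdge (j : Fin m)
  | x (i : Fin n)
  | y (j : Fin m)

namespace Block

variable {n m : ℕ}

/-- The number of letters of a block. -/
def len : Block n m → ℕ
  | pVert _ => 2
  | pEdge _ => 2
  | x _ => 3
  | y _ => 9

end Block

/-- A tag names the origin of a position of `α^(c)`: either the offset `r` in a block of a copy of
`α^(1)`, or a separator `#^(i)_γ`. Every copy of a block carries the same tags. -/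
inductive Tag (n m ℓ : ℕ) where
  | base (b : Block n m) (r : ℕ)
  | sep (i : ℕ) (γ : Fin ℓ)

namespace Tag

variable {n m ℓ : ℕ}

/-- The tags of one copy of a block. -/
def ofBlock (ℓ : ℕ) (b : Block n m) : List (Tag n m ℓ) :=
  (List.range b.len).map (base b)

/-- The tags of `P`. -/
def listP (n m ℓ : ℕ) : List (Tag n m ℓ) :=
  (List.finRange n).flatMap (fun i => ofBlock ℓ (.pVert i)) ++
    (List.finRange m).flatMap (fun j => ofBlock ℓ (.pEdge j))

/-- The tags of `X`. -/
def listX (n m ℓ : ℕ) : List (Tag n m ℓ) :=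
  (List.finRange n).flatMap (fun i => ofBlock ℓ (.x i))

/-- The tags of `Y`. -/
def listY (n m ℓ : ℕ) : List (Tag n m ℓ) :=
  (List.finRange m).flatMap (fun j => ofBlock ℓ (.y j))

/-- The tags of `α^(i)`. -/
def alpha (n m ℓ : ℕ) : ℕ → List (Tag n m ℓ)
  | 0 => []
  | 1 => listP n m ℓ ++ listX n m ℓ ++ listY n m ℓ
  | i + 2 => alpha n m ℓ (i + 1) ++
      (List.finRange ℓ).flatMap (fun γ => alpha n m ℓ (i + 1) ++ [sep (i + 1) γ])

/-- Every tagged position lies in a complete copy of its block. -/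
def Coherent (T : List (Tag n m ℓ)) : Prop :=
  ∀ q b r, T[q]? = some (base b r) →
    r ≤ q ∧ r < b.len ∧ ∀ r' < b.len, T[q - r + r']? = some (base b r')

theorem Coherent.nil : Coherent ([] : List (Tag n m ℓ)) := by
  intro q b r h
  simp at h

theorem Coherent.append {T U : List (Tag n m ℓ)} (hT : Coherent T) (hU : Coherent U) :
    Coherent (T ++ U) := by
  intro q b r h
  rcases Nat.lt_or_ge q T.length with h1 | h1
  · rw [List.getElem?_append_left h1] at h
    obtain ⟨a1, a2, a3⟩ := hT q b r h
    refine ⟨a1, a2, fun r' hr' => ?_⟩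
    have := a3 r' hr'
    rw [List.getElem?_append_left]
    · exact this
    · exact (List.getElem?_eq_some_iff.1 this).1
  · rw [List.getElem?_append_right h1] at h
    obtain ⟨a1, a2, a3⟩ := hU _ b r h
    refine ⟨by omega, a2, fun r' hr' => ?_⟩
    rw [List.getElem?_append_right (by omega), ← a3 r' hr']
    congr 1
    omega

theorem Coherent.flatMap {ι : Type*} {l : List ι} {f : ι → List (Tag n m ℓ)}
    (h : ∀ i ∈ l, Coherent (f i)) : Coherent (l.flatMap f) := by
  induction l with
  | nil => exact Coherent.nil
  | cons a l ih =>
    rw [List.flatMap_cons]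
    exact (h a (by simp)).append (ih fun i hi => h i (by simp [hi]))

theorem Coherent.ofBlock (b : Block n m) : Coherent (ofBlock ℓ b) := by
  intro q b' r h
  simp only [Tag.ofBlock, List.getElem?_map, Option.map_eq_some_iff, Tag.base.injEq] at h ⊢
  obtain ⟨a, h1, rfl, rfl⟩ := h
  obtain ⟨h2, h3⟩ := List.getElem?_eq_some_iff.1 h1
  simp only [List.length_range] at h2
  simp only [List.getElem_range] at h3
  subst h3
  refine ⟨le_rfl, h2, fun r' hr' => ⟨r', ?_, rfl, rfl⟩⟩
  simp [hr']

theorem Coherent.sep (i : ℕ) (γ : Fin ℓ) : Coherent ([sep i γ] : List (Tag n m ℓ)) := by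
  intro q b r h
  rcases q with _ | q <;> simp at h

theorem coherent_alpha (i : ℕ) : Coherent (alpha n m ℓ i) := by
  induction i using alpha.induct with
  | case1 => exact Coherent.nil
  | case2 =>
    refine ((Coherent.append ?_ ?_).append ?_).append ?_ <;>
      exact Coherent.flatMap fun _ _ => Coherent.ofBlock _
  | case3 i ih => exact ih.append (Coherent.flatMap fun γ _ => ih.append (Coherent.sep _ γ))

theorem mem_ofBlock {b : Block n m} {t : Tag n m ℓ} :
    t ∈ ofBlock ℓ b ↔ ∃ r < b.len, base b r = t := by
  simp [ofBlock]

theorem nodup_flatMap_ofBlock {k : ℕ} {f : Fin k → Block n m} (hf : Function.Injective f) :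
    ((List.finRange k).flatMap fun i => ofBlock ℓ (f i)).Nodup := by
  rw [List.nodup_flatMap]
  refine ⟨fun i _ => List.nodup_range.map fun a b h => by injection h, ?_⟩
  refine (List.nodup_finRange k).imp ?_
  intro i j hij t h1 h2
  obtain ⟨r, -, rfl⟩ := mem_ofBlock.1 h1
  obtain ⟨r', -, h⟩ := mem_ofBlock.1 h2
  injection h with h3 h4
  exact hij (hf h3).symm

theorem base_mem_listP {b : Block n m} {r : ℕ} :
    base b r ∈ listP n m ℓ ↔
      r < b.len ∧ ((∃ i, b = .pVert i) ∨ ∃ j, b = .pEdge j) := by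
  simp only [listP, List.mem_append, List.mem_flatMap, List.mem_finRange, true_and, mem_ofBlock,
    Tag.base.injEq]
  constructor
  · rintro (⟨i, r, h, rfl, rfl⟩ | ⟨i, r, h, rfl, rfl⟩)
    · exact ⟨h, .inl ⟨i, rfl⟩⟩
    · exact ⟨h, .inr ⟨i, rfl⟩⟩
  · rintro ⟨h, ⟨i, rfl⟩ | ⟨i, rfl⟩⟩
    · exact .inl ⟨i, r, h, rfl, rfl⟩
    · exact .inr ⟨i, r, h, rfl, rfl⟩

theorem base_mem_listX {b : Block n m} {r : ℕ} :
    base b r ∈ listX n m ℓ ↔ r < b.len ∧ ∃ i, b = .x i := by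
  simp only [listX, List.mem_flatMap, List.mem_finRange, true_and, mem_ofBlock, Tag.base.injEq]
  constructor
  · rintro ⟨i, r, h, rfl, rfl⟩
    exact ⟨h, i, rfl⟩
  · rintro ⟨h, i, rfl⟩
    exact ⟨i, r, h, rfl, rfl⟩

theorem base_mem_listY {b : Block n m} {r : ℕ} :
    base b r ∈ listY n m ℓ ↔ r < b.len ∧ ∃ j, b = .y j := by
  simp only [listY, List.mem_flatMap, List.mem_finRange, true_and, mem_ofBlock, Tag.base.injEq]
  constructor
  · rintro ⟨i, r, h, rfl, rfl⟩
    exact ⟨h, i, rfl⟩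
  · rintro ⟨h, i, rfl⟩
    exact ⟨i, r, h, rfl, rfl⟩

theorem sep_notMem_alpha_one (i : ℕ) (γ : Fin ℓ) : sep i γ ∉ alpha n m ℓ 1 := by
  simp [alpha, listP, listX, listY, mem_ofBlock]

theorem base_mem_alpha_one {b : Block n m} {r : ℕ} (hr : r < b.len) :
    base b r ∈ alpha n m ℓ 1 := by
  simp only [alpha, List.mem_append, base_mem_listP, base_mem_listX, base_mem_listY]
  cases b <;> simp [hr]

theorem nodup_alpha_one : (alpha n m ℓ 1).Nodup := by
  have h1 : (listP n m ℓ).Nodup := by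
    refine (nodup_flatMap_ofBlock fun a b h => by injection h).append
      (nodup_flatMap_ofBlock fun a b h => by injection h) ?_
    intro t h1 h2
    simp only [List.mem_flatMap, mem_ofBlock] at h1 h2
    obtain ⟨_, -, _, -, rfl⟩ := h1
    obtain ⟨_, -, _, -, h⟩ := h2
    simp at h
  have h2 : (listX n m ℓ).Nodup := nodup_flatMap_ofBlock fun a b h => by injection h
  have h3 : (listY n m ℓ).Nodup := nodup_flatMap_ofBlock fun a b h => by injection h
  refine (h1.append h2 ?_).append h3 ?_
  · rintro (⟨b, r⟩ | _) a1 a2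
    · rw [base_mem_listP] at a1
      rw [base_mem_listX] at a2
      obtain ⟨-, i, rfl⟩ := a2
      simp at a1
    · simp [listX, mem_ofBlock] at a2
  · rintro (⟨b, r⟩ | _) a1 a2
    · rw [List.mem_append, base_mem_listP, base_mem_listX] at a1
      rw [base_mem_listY] at a2
      obtain ⟨-, i, rfl⟩ := a2
      simp at a1
    · simp [listY, mem_ofBlock] at a2

end Tag

namespace GraphNumbering

variable {V : Type*} {G : SimpleGraph V} {n m : ℕ} (N : GraphNumbering G n m) {ℓ : ℕ}

/-- The letter at a tagged position. -/
def letter (N : GraphNumbering G n m) : Tag n m ℓ → Letter n m ℓ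
  | .base (.pVert i) 0 => .vert i
  | .base (.pVert i) _ => .sepP (Fin.castAdd m i)
  | .base (.pEdge j) 0 => .edge j
  | .base (.pEdge j) _ => .sepP (Fin.natAdd n j)
  | .base (.x i) 0 => .vert' i
  | .base (.x i) 1 => .vert i
  | .base (.x i) _ => .sepV i
  | .base (.y j) 0 => .vert' (N.fst j)
  | .base (.y j) 1 => .vert (N.fst j)
  | .base (.y j) 2 => .edge j
  | .base (.y j) 3 => .dollar j
  | .base (.y j) 4 => .vert' (N.snd j)
  | .base (.y j) 5 => .vert (N.snd j)
  | .base (.y j) 6 => .edge j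
  | .base (.y j) 7 => .dollar j
  | .base (.y j) _ => .sepE j
  | .sep i γ => .sepB i γ

theorem map_letter_alpha (i : ℕ) :
    (Tag.alpha n m ℓ i).map N.letter = N.strAlpha ℓ i := by
  induction i using Tag.alpha.induct with
  | case1 => rfl
  | case2 =>
    simp only [Tag.alpha, Tag.listP, Tag.listX, Tag.listY, strAlpha, strP, strX, strY,
      List.map_append, List.map_flatMap]
    rfl
  | case3 i ih =>
    simp only [Tag.alpha, strAlpha, strBeta, List.map_append, List.map_flatMap, ih]
    rfl

theorem getElem?_strAlpha (c p : ℕ) :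
    (N.strAlpha ℓ c)[p]? = (Tag.alpha n m ℓ c)[p]?.map N.letter := by
  rw [← N.map_letter_alpha, List.getElem?_map]

theorem length_alpha (c : ℕ) : (Tag.alpha n m ℓ c).length = (N.strAlpha ℓ c).length := by
  rw [← N.map_letter_alpha, List.length_map]

/-- The distinct endpoints of an edge have distinct numbers. -/
theorem fst_ne_snd (j : Fin m) : N.fst j ≠ N.snd j := by
  intro h
  have h1 := (N.edge j).2
  rw [N.edge_eq, h, SimpleGraph.mem_edgeSet] at h1
  exact G.irrefl h1

variable {c q : ℕ}

/-- The tag behind a letter of `α^(c)`; all further facts on single letters come from it. -/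
theorem exists_tag {a : Letter n m ℓ} (h : (N.strAlpha ℓ c)[q]? = some a) :
    ∃ t, (Tag.alpha n m ℓ c)[q]? = some t ∧ N.letter t = a := by
  rwa [getElem?_strAlpha, Option.map_eq_some_iff] at h

theorem tag_of_vert {i : Fin n} (h : (N.strAlpha ℓ c)[q]? = some (.vert i)) :
    (Tag.alpha n m ℓ c)[q]? = some (.base (.pVert i) 0) ∨
    (Tag.alpha n m ℓ c)[q]? = some (.base (.x i) 1) ∨
    (∃ j, (Tag.alpha n m ℓ c)[q]? = some (.base (.y j) 1) ∧ N.fst j = i) ∨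
    (∃ j, (Tag.alpha n m ℓ c)[q]? = some (.base (.y j) 5) ∧ N.snd j = i) := by
  obtain ⟨⟨b, r⟩ | _, h1, h2⟩ := N.exists_tag h
  · obtain ⟨-, h3, -⟩ := Tag.coherent_alpha c _ _ _ h1
    cases b <;> simp only [Block.len] at h3 <;> interval_cases r <;> simp_all [letter]
  · simp [letter] at h2

theorem tag_of_vert' {i : Fin n} (h : (N.strAlpha ℓ c)[q]? = some (.vert' i)) :
    (Tag.alpha n m ℓ c)[q]? = some (.base (.x i) 0) ∨
    (∃ j, (Tag.alpha n m ℓ c)[q]? = some (.base (.y j) 0) ∧ N.fst j = i) ∨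
    (∃ j, (Tag.alpha n m ℓ c)[q]? = some (.base (.y j) 4) ∧ N.snd j = i) := by
  obtain ⟨⟨b, r⟩ | _, h1, h2⟩ := N.exists_tag h
  · obtain ⟨-, h3, -⟩ := Tag.coherent_alpha c _ _ _ h1
    cases b <;> simp only [Block.len] at h3 <;> interval_cases r <;> simp_all [letter]
  · simp [letter] at h2

theorem tag_of_edge {j : Fin m} (h : (N.strAlpha ℓ c)[q]? = some (.edge j)) :
    (Tag.alpha n m ℓ c)[q]? = some (.base (.pEdge j) 0) ∨
    (Tag.alpha n m ℓ c)[q]? = some (.base (.y j) 2) ∨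
    (Tag.alpha n m ℓ c)[q]? = some (.base (.y j) 6) := by
  obtain ⟨⟨b, r⟩ | _, h1, h2⟩ := N.exists_tag h
  · obtain ⟨-, h3, -⟩ := Tag.coherent_alpha c _ _ _ h1
    cases b <;> simp only [Block.len] at h3 <;> interval_cases r <;> simp_all [letter]
  · simp [letter] at h2

theorem tag_of_dollar {j : Fin m} (h : (N.strAlpha ℓ c)[q]? = some (.dollar j)) :
    (Tag.alpha n m ℓ c)[q]? = some (.base (.y j) 3) ∨
    (Tag.alpha n m ℓ c)[q]? = some (.base (.y j) 7) := by
  obtain ⟨⟨b, r⟩ | _, h1, h2⟩ := N.exists_tag h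
  · obtain ⟨-, h3, -⟩ := Tag.coherent_alpha c _ _ _ h1
    cases b <;> simp only [Block.len] at h3 <;> interval_cases r <;> simp_all [letter]
  · simp [letter] at h2

theorem tag_of_sepP_left {i : Fin n}
    (h : (N.strAlpha ℓ c)[q]? = some (.sepP (Fin.castAdd m i))) :
    (Tag.alpha n m ℓ c)[q]? = some (.base (.pVert i) 1) := by
  obtain ⟨⟨b, r⟩ | _, h1, h2⟩ := N.exists_tag h
  · obtain ⟨-, h3, -⟩ := Tag.coherent_alpha c _ _ _ h1
    cases b <;> simp only [Block.len] at h3 <;> interval_cases r <;>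
      simp_all [letter, Fin.ext_iff]
    omega
  · simp [letter] at h2

theorem tag_of_sepP_right {j : Fin m}
    (h : (N.strAlpha ℓ c)[q]? = some (.sepP (Fin.natAdd n j))) :
    (Tag.alpha n m ℓ c)[q]? = some (.base (.pEdge j) 1) := by
  obtain ⟨⟨b, r⟩ | _, h1, h2⟩ := N.exists_tag h
  · obtain ⟨-, h3, -⟩ := Tag.coherent_alpha c _ _ _ h1
    cases b <;> simp only [Block.len] at h3 <;> interval_cases r <;>
      simp_all [letter, Fin.ext_iff]
    omega
  · simp [letter] at h2

theorem tag_of_sepV {i : Fin n} (h : (N.strAlpha ℓ c)[q]? = some (.sepV i)) :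
    (Tag.alpha n m ℓ c)[q]? = some (.base (.x i) 2) := by
  obtain ⟨⟨b, r⟩ | _, h1, h2⟩ := N.exists_tag h
  · obtain ⟨-, h3, -⟩ := Tag.coherent_alpha c _ _ _ h1
    cases b <;> simp only [Block.len] at h3 <;> interval_cases r <;> simp_all [letter]
  · simp [letter] at h2

theorem tag_of_sepE {j : Fin m} (h : (N.strAlpha ℓ c)[q]? = some (.sepE j)) :
    (Tag.alpha n m ℓ c)[q]? = some (.base (.y j) 8) := by
  obtain ⟨⟨b, r⟩ | _, h1, h2⟩ := N.exists_tag h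
  · obtain ⟨-, h3, -⟩ := Tag.coherent_alpha c _ _ _ h1
    cases b <;> simp only [Block.len] at h3 <;> interval_cases r <;> simp_all [letter]
  · simp [letter] at h2

theorem tag_of_sepB {i : ℕ} {γ : Fin ℓ} (h : (N.strAlpha ℓ c)[q]? = some (.sepB i γ)) :
    (Tag.alpha n m ℓ c)[q]? = some (.sep i γ) := by
  obtain ⟨⟨b, r⟩ | _, h1, h2⟩ := N.exists_tag h
  · obtain ⟨-, h3, -⟩ := Tag.coherent_alpha c _ _ _ h1
    cases b <;> simp only [Block.len] at h3 <;> interval_cases r <;> simp_all [letter]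
  · simp_all [letter]

/-- The letter at offset `r'` of the copy of a block around a tagged position. -/
theorem getElem?_strAlpha_of_block {b : Block n m} {r : ℕ}
    (h : (Tag.alpha n m ℓ c)[q]? = some (.base b r)) (r' : ℕ) (hr' : r' < b.len) :
    (N.strAlpha ℓ c)[q - r + r']? = some (N.letter (.base b r')) := by
  rw [getElem?_strAlpha, (Tag.coherent_alpha c _ _ _ h).2.2 r' hr']
  rfl

/-- `v_i e_j` occurs only in `Y_j`. -/
theorem tag_of_vert_edge {i : Fin n} {j : Fin m} (h : (N.strAlpha ℓ c)[q]? = some (.vert i))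
    (h' : (N.strAlpha ℓ c)[q + 1]? = some (.edge j)) :
    ((Tag.alpha n m ℓ c)[q]? = some (.base (.y j) 1) ∧ N.fst j = i) ∨
    ((Tag.alpha n m ℓ c)[q]? = some (.base (.y j) 5) ∧ N.snd j = i) := by
  rcases N.tag_of_vert h with h1 | h1 | ⟨j', h1, rfl⟩ | ⟨j', h1, rfl⟩
  · have := N.getElem?_strAlpha_of_block h1 1 (by simp [Block.len])
    simp [h', letter] at this
  · have := N.getElem?_strAlpha_of_block h1 2 (by simp [Block.len])
    have h2 := (Tag.coherent_alpha c _ _ _ h1).1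
    rw [show q - 1 + 2 = q + 1 by omega, h'] at this
    simp [letter] at this
  · have := N.getElem?_strAlpha_of_block h1 2 (by simp [Block.len])
    have h2 := (Tag.coherent_alpha c _ _ _ h1).1
    rw [show q - 1 + 2 = q + 1 by omega, h'] at this
    simp only [letter, Option.some.injEq, Letter.edge.injEq] at this
    subst this
    exact .inl ⟨h1, rfl⟩
  · have := N.getElem?_strAlpha_of_block h1 6 (by simp [Block.len])
    have h2 := (Tag.coherent_alpha c _ _ _ h1).1
    rw [show q - 5 + 6 = q + 1 by omega, h'] at this
    simp only [letter, Option.some.injEq, Letter.edge.injEq] at this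
    subst this
    exact .inr ⟨h1, rfl⟩

end GraphNumbering

/-! ### Occurrences and squares in the strings `α^(i)` -/

/-- The string `w` occurs in `s` at position `x`. -/
def OccursAt {A : Type*} (w s : List A) (x : ℕ) : Prop :=
  ∀ r < w.length, s[x + r]? = w[r]?

theorem OccursAt.of_prefix {A : Type*} {w s : List A} (h : w <+: s) : OccursAt w s 0 := by
  intro r hr
  rw [zero_add, List.prefix_iff_getElem?.1 h r hr, List.getElem?_eq_getElem hr]

section Separators

variable {A ι : Type*} {a : List A} {f : ι → A}

theorem length_flatMap_sep (a : List A) (f : ι → A) (l : List ι) :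
    (l.flatMap fun i => a ++ [f i]).length = l.length * (a.length + 1) := by
  simp

theorem getElem?_flatMap_sep_body {l : List ι} {k r : ℕ} (hk : k < l.length)
    (hr : r < a.length) :
    (l.flatMap fun i => a ++ [f i])[k * (a.length + 1) + r]? = a[r]? := by
  induction l generalizing k with
  | nil => simp at hk
  | cons i l ih =>
    rw [List.flatMap_cons]
    rcases k with _ | k
    · rw [List.getElem?_append_left (by simp; omega), List.getElem?_append_left (by omega)]
      simp
    · rw [List.getElem?_append_right (by simp; rw [Nat.succ_mul]; omega), ← ih (k := k)]
      · congr 1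
        simp [Nat.succ_mul]
        omega
      · simpa using hk

theorem getElem?_flatMap_sep_sep {l : List ι} {k : ℕ} (hk : k < l.length) :
    (l.flatMap fun i => a ++ [f i])[k * (a.length + 1) + a.length]? = some (f l[k]) := by
  induction l generalizing k with
  | nil => simp at hk
  | cons i l ih =>
    rw [List.flatMap_cons]
    rcases k with _ | k
    · simp
    · rw [List.getElem?_append_right (by simp [Nat.succ_mul])]
      simp only [List.getElem_cons_succ]
      rw [← ih (k := k)]
      congr 1
      simp [Nat.succ_mul]
      omega

theorem exists_of_getElem?_flatMap_sep {l : List ι} {q : ℕ} {z : A} (hz : z ∉ a)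
    (h : (l.flatMap fun i => a ++ [f i])[q]? = some z) :
    ∃ k, ∃ hk : k < l.length, q = k * (a.length + 1) + a.length ∧ f l[k] = z := by
  have hq : q < l.length * (a.length + 1) := by
    rw [← length_flatMap_sep a f l]
    exact (List.getElem?_eq_some_iff.1 h).1
  have hk : q / (a.length + 1) < l.length := Nat.div_lt_of_lt_mul (by rwa [mul_comm])
  have hdm : q = q / (a.length + 1) * (a.length + 1) + q % (a.length + 1) := by
    rw [mul_comm]; exact (Nat.div_add_mod _ _).symm
  have hr := Nat.mod_lt q (Nat.succ_pos a.length)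
  generalize q / (a.length + 1) = k at *
  generalize q % (a.length + 1) = r at *
  subst hdm
  rcases Nat.lt_or_ge r a.length with h1 | h1
  · rw [getElem?_flatMap_sep_body hk h1] at h
    exact absurd (List.mem_of_getElem? h) hz
  · obtain rfl : r = a.length := by omega
    rw [getElem?_flatMap_sep_sep hk] at h
    exact ⟨k, hk, rfl, by simpa using h⟩

end Separators

namespace GraphNumbering

variable {V : Type*} {G : SimpleGraph V} {n m : ℕ} (N : GraphNumbering G n m) {ℓ : ℕ}

theorem strAlpha_succ {i : ℕ} (hi : 1 ≤ i) :
    N.strAlpha ℓ (i + 1) = N.strAlpha ℓ i ++ strBeta i (N.strAlpha ℓ i) := by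
  obtain ⟨i, rfl⟩ := Nat.exists_eq_succ_of_ne_zero (by omega : i ≠ 0)
  rfl

theorem length_strAlpha_succ {i : ℕ} (hi : 1 ≤ i) :
    (N.strAlpha ℓ (i + 1)).length =
      (N.strAlpha ℓ i).length + ℓ * ((N.strAlpha ℓ i).length + 1) := by
  rw [strAlpha_succ N hi, List.length_append, strBeta, length_flatMap_sep, List.length_finRange]

theorem strAlpha_prefix {i j : ℕ} (hi : 1 ≤ i) (hij : i ≤ j) :
    N.strAlpha ℓ i <+: N.strAlpha ℓ j := by
  induction j, hij using Nat.le_induction with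
  | base => exact List.prefix_rfl
  | succ j hj ih =>
    rw [strAlpha_succ N (hi.trans hj)]
    exact ih.trans (List.prefix_append _ _)

theorem length_strAlpha_lt (hℓ : 0 < ℓ) {i j : ℕ} (hi : 1 ≤ i) (hij : i < j) :
    (N.strAlpha ℓ i).length < (N.strAlpha ℓ j).length := by
  refine lt_of_lt_of_le ?_ (N.strAlpha_prefix (by omega) (Nat.succ_le_of_lt hij)).length_le
  rw [N.length_strAlpha_succ hi]
  have := Nat.mul_le_mul_right ((N.strAlpha ℓ i).length + 1) hℓ
  omega

theorem length_strAlpha_one_pos (hn : 0 < n) : 0 < (N.strAlpha ℓ 1).length := by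
  rw [← N.length_alpha]
  exact List.length_pos_of_mem
    (Tag.base_mem_alpha_one (b := .pVert ⟨0, hn⟩) (r := 0) (by simp [Block.len]))

theorem length_strAlpha_pos (hn : 0 < n) {i : ℕ} (hi : 1 ≤ i) : 0 < (N.strAlpha ℓ i).length :=
  (N.length_strAlpha_one_pos hn).trans_le (N.strAlpha_prefix le_rfl hi).length_le

/-- The start of the block number `k` of `β^(i)` in `α^(i + 1)`. -/
def blockStart (N : GraphNumbering G n m) (ℓ i k : ℕ) : ℕ :=
  (N.strAlpha ℓ i).length + k * ((N.strAlpha ℓ i).length + 1)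

theorem occursAt_blockStart {i k : ℕ} (hi : 1 ≤ i) (hk : k < ℓ) :
    OccursAt (N.strAlpha ℓ i) (N.strAlpha ℓ (i + 1)) (N.blockStart ℓ i k) := by
  intro r hr
  rw [strAlpha_succ N hi, blockStart, List.getElem?_append_right (by omega), strBeta,
    show (N.strAlpha ℓ i).length + k * ((N.strAlpha ℓ i).length + 1) + r -
      (N.strAlpha ℓ i).length = k * ((N.strAlpha ℓ i).length + 1) + r by omega,
    getElem?_flatMap_sep_body (by simpa using hk) hr]

theorem getElem?_strAlpha_sep {i k : ℕ} (hi : 1 ≤ i) (hk : k < ℓ) :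
    (N.strAlpha ℓ (i + 1))[N.blockStart ℓ i k + (N.strAlpha ℓ i).length]? =
      some (.sepB i ⟨k, hk⟩) := by
  rw [strAlpha_succ N hi, blockStart, List.getElem?_append_right (by omega), strBeta,
    show (N.strAlpha ℓ i).length + k * ((N.strAlpha ℓ i).length + 1) + (N.strAlpha ℓ i).length -
      (N.strAlpha ℓ i).length =
      k * ((N.strAlpha ℓ i).length + 1) + (N.strAlpha ℓ i).length by omega,
    getElem?_flatMap_sep_sep (by simpa using hk)]
  simp

theorem level_of_sepB_mem {i i' : ℕ} {γ : Fin ℓ} (h : .sepB i' γ ∈ N.strAlpha ℓ i) :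
    1 ≤ i' ∧ i' < i := by
  induction i using Tag.alpha.induct with
  | case1 => simp [strAlpha] at h
  | case2 => simp [strAlpha, strP, strX, strY] at h
  | case3 i ih =>
    simp only [strAlpha, strBeta, List.mem_append, List.mem_flatMap, List.mem_singleton,
      Letter.sepB.injEq] at h
    rcases h with h | ⟨_, -, h | h⟩
    · have := ih h
      omega
    · have := ih h
      omega
    · omega

theorem sepB_mem {i i' : ℕ} (γ : Fin ℓ) (h : 1 ≤ i') (h' : i' < i) :
    .sepB i' γ ∈ N.strAlpha ℓ i :=
  (N.strAlpha_prefix (by omega) (Nat.succ_le_of_lt h')).subset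
    (List.mem_of_getElem? (N.getElem?_strAlpha_sep h γ.2))

theorem eq_of_getElem?_sepB {i q : ℕ} (hi : 1 ≤ i) {γ : Fin ℓ}
    (h : (N.strAlpha ℓ (i + 1))[q]? = some (.sepB i γ)) :
    q = N.blockStart ℓ i γ + (N.strAlpha ℓ i).length := by
  have hz : .sepB i γ ∉ N.strAlpha ℓ i := fun h1 => by
    have := N.level_of_sepB_mem h1
    omega
  rw [strAlpha_succ N hi] at h
  rcases Nat.lt_or_ge q (N.strAlpha ℓ i).length with h1 | h1
  · rw [List.getElem?_append_left h1] at h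
    exact absurd (List.mem_of_getElem? h) hz
  · rw [List.getElem?_append_right h1] at h
    obtain ⟨k, hk, h2, h3⟩ := exists_of_getElem?_flatMap_sep hz h
    simp only [List.getElem_finRange, Letter.sepB.injEq, true_and] at h3
    subst h3
    simp only [blockStart, Fin.val_cast]
    omega

/-- The last letter of `α^(i)` occurs in it only once. -/
theorem eq_last_of_getElem? (hn : 0 < n) (hℓ : 0 < ℓ) {i r : ℕ} (hi : 1 ≤ i)
    (hr : r < (N.strAlpha ℓ i).length)
    (h : (N.strAlpha ℓ i)[r]? = (N.strAlpha ℓ i)[(N.strAlpha ℓ i).length - 1]?) :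
    r + 1 = (N.strAlpha ℓ i).length := by
  have hpos := N.length_strAlpha_pos (ℓ := ℓ) hn hi
  obtain rfl | h1 := Nat.eq_or_lt_of_le hi
  · rw [N.getElem?_strAlpha 1 (_ - 1)] at h
    have hlast : ∃ t, (Tag.alpha n m ℓ 1)[(N.strAlpha ℓ 1).length - 1]? = some t ∧
        ((∃ j, t = .base (.y j) 8) ∨ ∃ i, t = .base (.x i) 2) := by
      rw [← N.length_alpha]
      rw [← List.getLast?_eq_getElem?]
      simp only [Tag.alpha, Tag.listX, Tag.listY]
      rcases m with _ | m
      · obtain ⟨n, rfl⟩ := Nat.exists_eq_succ_of_ne_zero hn.ne'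
        simp only [List.finRange_zero, List.flatMap_nil, List.append_nil, List.finRange_succ_last,
          List.flatMap_append, List.flatMap_singleton, List.getLast?_append]
        refine ⟨_, rfl, .inr ⟨_, rfl⟩⟩
      · simp only [List.finRange_succ_last,
          List.flatMap_append, List.flatMap_singleton, List.getLast?_append]
        refine ⟨_, rfl, .inl ⟨_, rfl⟩⟩
    obtain ⟨t, ht, h2⟩ := hlast
    rw [ht, Option.map_some] at h
    have h3 : (Tag.alpha n m ℓ 1)[r]? = some t := by
      rcases h2 with ⟨j, rfl⟩ | ⟨i, rfl⟩
      · exact N.tag_of_sepE h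
      · exact N.tag_of_sepV h
    have h4 := (List.getElem?_inj (by rw [N.length_alpha]; exact hr) Tag.nodup_alpha_one).1
      (h3.trans ht.symm)
    omega
  · obtain ⟨e, rfl⟩ : ∃ e, i = e + 1 := ⟨i - 1, by omega⟩
    have he : 1 ≤ e := by omega
    have h2 := N.getElem?_strAlpha_sep he (Nat.sub_lt hℓ one_pos)
    have h3 : N.blockStart ℓ e (ℓ - 1) + (N.strAlpha ℓ e).length + 1 =
        (N.strAlpha ℓ (e + 1)).length := by
      rw [N.length_strAlpha_succ he, blockStart, Nat.sub_mul]
      have := Nat.mul_le_mul_right ((N.strAlpha ℓ e).length + 1) hℓ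
      omega
    rw [show (N.strAlpha ℓ (e + 1)).length - 1 =
      N.blockStart ℓ e (ℓ - 1) + (N.strAlpha ℓ e).length by omega, h2] at h
    have := N.eq_of_getElem?_sepB he h
    simp only at this
    omega

/-- Occurrences of `α^(i)` do not overlap. -/
theorem not_overlap (hn : 0 < n) (hℓ : 0 < ℓ) {i z b : ℕ} {s : List (Letter n m ℓ)} (hi : 1 ≤ i)
    (hz : OccursAt (N.strAlpha ℓ i) s z) (hb : OccursAt (N.strAlpha ℓ i) s b) (h : z < b) :
    z + (N.strAlpha ℓ i).length ≤ b := by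
  by_contra! h1
  have h2 := hz ((N.strAlpha ℓ i).length - 1) (by omega)
  have h3 := hb (z + (N.strAlpha ℓ i).length - 1 - b) (by omega)
  rw [show b + (z + (N.strAlpha ℓ i).length - 1 - b) = z + ((N.strAlpha ℓ i).length - 1) by omega,
    h2] at h3
  have := N.eq_last_of_getElem? hn hℓ hi (by omega) h3.symm
  omega

/-- A square of period at least `|α^(1)|` in `α^(i)` is an occurrence of some `α^(j) α^(j)`. -/
theorem square_strAlpha (hn : 0 < n) (hℓ : 0 < ℓ) {i a d : ℕ} (hi : 1 ≤ i)
    (hd : (N.strAlpha ℓ 1).length ≤ d) (had : a + 2 * d ≤ (N.strAlpha ℓ i).length)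
    (h : ∀ r < d, (N.strAlpha ℓ i)[a + r]? = (N.strAlpha ℓ i)[a + d + r]?) :
    ∃ j, 1 ≤ j ∧ (N.strAlpha ℓ j).length = d ∧
      OccursAt (N.strAlpha ℓ j) (N.strAlpha ℓ i) (a + d) := by
  have h1pos := N.length_strAlpha_one_pos (ℓ := ℓ) hn
  induction i, hi using Nat.le_induction generalizing a with
  | base => omega
  | succ i hi ih =>
    have hLpos := N.length_strAlpha_pos (ℓ := ℓ) hn hi
    -- a square inside an occurrence of `α^(i)`
    have inner : ∀ x, OccursAt (N.strAlpha ℓ i) (N.strAlpha ℓ (i + 1)) x → x ≤ a →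
        a + 2 * d ≤ x + (N.strAlpha ℓ i).length →
        ∃ j, 1 ≤ j ∧ (N.strAlpha ℓ j).length = d ∧
          OccursAt (N.strAlpha ℓ j) (N.strAlpha ℓ (i + 1)) (a + d) := by
      intro x hx hxa hxd
      obtain ⟨j, hj, hjd, hocc⟩ := ih (a := a - x) (by omega) (by
        intro r hr
        rw [← hx _ (by omega), ← hx _ (by omega)]
        convert h r hr using 2 <;> omega)
      refine ⟨j, hj, hjd, fun r hr => ?_⟩
      rw [← hocc r hr, ← hx _ (by omega)]
      congr 1
      omega
    -- no separator of level `i` lies in the square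
    have nosep : ∀ k < ℓ, ¬ (a ≤ N.blockStart ℓ i k + (N.strAlpha ℓ i).length ∧
        N.blockStart ℓ i k + (N.strAlpha ℓ i).length < a + 2 * d) := by
      rintro k hk ⟨h1, h2⟩
      have hs := N.getElem?_strAlpha_sep hi hk
      generalize hp : N.blockStart ℓ i k + (N.strAlpha ℓ i).length = p at *
      rcases Nat.lt_or_ge p (a + d) with h3 | h3
      · have h4 := h (p - a) (by omega)
        rw [show a + (p - a) = p by omega, hs] at h4
        have := N.eq_of_getElem?_sepB hi h4.symm
        simp only at this
        omega
      · have h4 := h (p - a - d) (by omega)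
        rw [show a + d + (p - a - d) = p by omega, hs] at h4
        have := N.eq_of_getElem?_sepB hi h4
        simp only at this
        omega
    have h0 := OccursAt.of_prefix (N.strAlpha_prefix (ℓ := ℓ) hi (Nat.le_succ i))
    have hlen := N.length_strAlpha_succ (ℓ := ℓ) hi
    rcases Nat.lt_or_ge a (N.strAlpha ℓ i).length with ha | ha
    · rcases Nat.lt_or_ge (N.strAlpha ℓ i).length (a + 2 * d) with ha2 | ha2
      · -- the square straddles the boundary of the prefix `α^(i) α^(i)`
        have h1 := N.occursAt_blockStart hi hℓ
        have h2 := nosep 0 hℓ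
        simp only [blockStart, zero_mul, add_zero] at h1 h2
        have hl := h0 ((N.strAlpha ℓ i).length - 1) (by omega)
        rw [zero_add] at hl
        rcases Nat.lt_or_ge ((N.strAlpha ℓ i).length - 1) (a + d) with h3 | h3
        · have h4 := h ((N.strAlpha ℓ i).length - 1 - a) (by omega)
          rw [show a + ((N.strAlpha ℓ i).length - 1 - a) = (N.strAlpha ℓ i).length - 1 by omega,
            show a + d + ((N.strAlpha ℓ i).length - 1 - a) = (N.strAlpha ℓ i).length + (d - 1)
              by omega, hl, h1 _ (by omega)] at h4
          have h5 := N.eq_last_of_getElem? hn hℓ hi (by omega) h4.symm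
          refine ⟨i, hi, by omega, ?_⟩
          rwa [show a + d = (N.strAlpha ℓ i).length by omega]
        · have h4 := h ((N.strAlpha ℓ i).length - 1 - a - d) (by omega)
          rw [show a + d + ((N.strAlpha ℓ i).length - 1 - a - d) =
              (N.strAlpha ℓ i).length - 1 by omega,
            show a + ((N.strAlpha ℓ i).length - 1 - a - d) =
              0 + ((N.strAlpha ℓ i).length - 1 - d) by omega, hl, h0 _ (by omega)] at h4
          have h5 := N.eq_last_of_getElem? hn hℓ hi (by omega) h4
          omega
      · exact inner 0 h0 (Nat.zero_le a) (by omega)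
    · have hk : (a - (N.strAlpha ℓ i).length) / ((N.strAlpha ℓ i).length + 1) < ℓ := by
        refine Nat.div_lt_of_lt_mul ?_
        rw [mul_comm]
        omega
      have hdm := Nat.div_add_mod (a - (N.strAlpha ℓ i).length) ((N.strAlpha ℓ i).length + 1)
      have hr := Nat.mod_lt (a - (N.strAlpha ℓ i).length) (Nat.add_one_pos (N.strAlpha ℓ i).length)
      generalize (a - (N.strAlpha ℓ i).length) / ((N.strAlpha ℓ i).length + 1) = k at *
      have h2 := nosep k hk
      have h1 := N.occursAt_blockStart hi hk
      rw [mul_comm] at hdm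
      simp only [blockStart] at h1 h2
      exact inner _ h1 (by omega) (by omega)

end GraphNumbering

/-! ### Copied occurrences -/

/-- The sources of an occurrence of `w` in the proper prefix of a phrase do not wrap around, if
occurrences of `w` do not overlap and `w` occurs in the middle of every square of period at least
`|w|`. A wrap would give an overlap of `w` with itself, or a square with an occurrence of `w`
strictly around its middle. -/
theorem LZParsing.sourcePos_add {A : Type*} {s : List A} (φ : LZParsing s) {w : List A} {y : ℕ}
    {j : Fin φ.size} (hocc : OccursAt w s y) (hin : ∀ r < w.length, φ.InPrefix (y + r) j)
    (hover : ∀ z b, OccursAt w s z → OccursAt w s b → z < b → z + w.length ≤ b)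
    (hsq : ∀ a d, w.length ≤ d → a + 2 * d ≤ s.length →
      (∀ r < d, s[a + r]? = s[a + d + r]?) → OccursAt w s (a + d))
    {r : ℕ} (hr : r < w.length) : φ.sourcePos (y + r) j = φ.sourcePos y j + r := by
  have hy := hin 0 (by omega)
  have hlast := (hin (w.length - 1) (by omega)).2
  have h0 := φ.src_lt_of_inPrefix hy
  rw [add_zero] at hy
  have hle := φ.cut_le_length j.succ
  -- the source of `y` carries an occurrence of `w`, although it may run past the start of the
  -- phrase
  have hz : OccursAt w s (φ.sourcePos y j) := fun r hr => by
    rw [φ.getElem?_sourcePos_add hy (hin r hr), hocc r hr]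
  have hper := fun q hq => φ.getElem?_period (j := j) (q := q) hq
  have hmod := Nat.mod_lt (y - φ.cut j.castSucc) (Nat.sub_pos_of_lt h0)
  have hmodle := Nat.mod_le (y - φ.cut j.castSucc) (φ.cut j.castSucc - φ.src j)
  have key : (y - φ.cut j.castSucc) % (φ.cut j.castSucc - φ.src j) + w.length ≤
      φ.cut j.castSucc - φ.src j := by
    by_contra! hwrap
    have h1 := hy.1
    unfold sourcePos at hz
    generalize (y - φ.cut j.castSucc) % (φ.cut j.castSucc - φ.src j) = e at *
    have hzd : OccursAt w s (φ.src j + e + (φ.cut j.castSucc - φ.src j)) := by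
      intro r hr
      rw [← hz r hr, add_right_comm]
      exact (hper _ (by omega) ⟨by omega, by omega⟩).symm
    have hd := hover _ _ hz hzd (by omega)
    have hb := hsq (φ.src j) (φ.cut j.castSucc - φ.src j) (by omega) (by omega) (by
      intro r hr
      rw [add_right_comm]
      exact hper _ (by omega) ⟨by omega, by omega⟩)
    have := hover _ _ hz hb (by omega)
    omega
  have h1 := hy.1
  unfold sourcePos
  rw [show y + r - φ.cut j.castSucc = (y - φ.cut j.castSucc) + r by omega, Nat.add_mod,
    Nat.mod_eq_of_lt (show r < φ.cut j.castSucc - φ.src j by omega), Nat.mod_eq_of_lt (by omega)]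
  omega

/-! ### Counting phrase ends by tags -/

open Classical in
/-- The offsets `r` such that some position in `P` is tagged as offset `r` of the block `b`. -/
noncomputable def Tag.offsets {n m ℓ : ℕ} (T : List (Tag n m ℓ)) (P : Finset ℕ) (b : Block n m) :
    Finset ℕ :=
  {r ∈ Finset.range b.len | ∃ p ∈ P, T[p]? = some (.base b r)}

namespace Tag

variable {n m ℓ : ℕ} {T : List (Tag n m ℓ)} {P : Finset ℕ}

theorem mem_offsets {b : Block n m} {r : ℕ} :
    r ∈ offsets T P b ↔ r < b.len ∧ ∃ p ∈ P, T[p]? = some (.base b r) := by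
  simp [offsets]

theorem mem_offsets_of_tag {c : ℕ} {b : Block n m} {r p : ℕ} (hp : p ∈ P)
    (h : (alpha n m ℓ c)[p]? = some (.base b r)) : r ∈ offsets (alpha n m ℓ c) P b :=
  mem_offsets.2 ⟨(coherent_alpha c _ _ _ h).2.1, p, hp, h⟩

theorem offsets_mono {P Q : Finset ℕ} (h : P ⊆ Q) (b : Block n m) :
    offsets T P b ⊆ offsets T Q b := by
  intro r hr
  obtain ⟨h1, p, h2, h3⟩ := mem_offsets.1 hr
  exact mem_offsets.2 ⟨h1, p, h h2, h3⟩

open Classical in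
theorem sum_card_offsets_le {κ : Type*} [Fintype κ] {f : κ → Block n m}
    (hf : Function.Injective f) : ∑ i, (offsets T P (f i)).card ≤ P.card := by
  have h1 : ∀ i, (offsets T P (f i)).card ≤
      (P.filter fun p => ∃ r, T[p]? = some (.base (f i) r)).card := by
    intro i
    refine (Finset.card_le_card (t := (P.filter fun p => ∃ r, T[p]? = some (.base (f i) r)).image
      fun p => match T[p]? with
        | some (.base _ r) => r
        | _ => 0) ?_).trans Finset.card_image_le
    intro r hr
    obtain ⟨-, p, h2, h3⟩ := mem_offsets.1 hr
    exact Finset.mem_image.2 ⟨p, Finset.mem_filter.2 ⟨h2, r, h3⟩, by rw [h3]⟩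
  refine (Finset.sum_le_sum fun i _ => h1 i).trans ?_
  rw [← Finset.card_biUnion]
  · exact Finset.card_le_card (Finset.biUnion_subset.2 fun i _ => Finset.filter_subset _ _)
  · intro i _ i' _ hii
    refine Finset.disjoint_left.2 fun p hp hp' => hii ?_
    obtain ⟨-, r, h⟩ := Finset.mem_filter.1 hp
    obtain ⟨-, r', h'⟩ := Finset.mem_filter.1 hp'
    rw [h, Option.some.injEq, base.injEq] at h'
    exact hf h'.1

/-- The offsets at which the first copy of `α^(1)` forces phrase ends. -/
structure Forced (T : List (Tag n m ℓ)) (P : Finset ℕ) : Prop where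
  pVert : ∀ i, 0 ∈ offsets T P (.pVert i) ∧ 1 ∈ offsets T P (.pVert i)
  pEdge : ∀ j, 0 ∈ offsets T P (.pEdge j) ∧ 1 ∈ offsets T P (.pEdge j)
  x : ∀ i, 0 ∈ offsets T P (.x i) ∧ 2 ∈ offsets T P (.x i)
  y : ∀ j, 3 ∈ offsets T P (.y j) ∧ 8 ∈ offsets T P (.y j)
  y_fst : ∀ j, 1 ∈ offsets T P (.y j) ∨ 2 ∈ offsets T P (.y j)
  y_snd : ∀ j, 5 ∈ offsets T P (.y j) ∨ 6 ∈ offsets T P (.y j)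

theorem Forced.mono {P Q : Finset ℕ} (h : Forced T P) (hPQ : P ⊆ Q) : Forced T Q where
  pVert i := (h.pVert i).imp (fun h => offsets_mono hPQ _ h) (fun h => offsets_mono hPQ _ h)
  pEdge i := (h.pEdge i).imp (fun h => offsets_mono hPQ _ h) (fun h => offsets_mono hPQ _ h)
  x i := (h.x i).imp (fun h => offsets_mono hPQ _ h) (fun h => offsets_mono hPQ _ h)
  y i := (h.y i).imp (fun h => offsets_mono hPQ _ h) (fun h => offsets_mono hPQ _ h)
  y_fst i := (h.y_fst i).imp (fun h => offsets_mono hPQ _ h) (fun h => offsets_mono hPQ _ h)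
  y_snd i := (h.y_snd i).imp (fun h => offsets_mono hPQ _ h) (fun h => offsets_mono hPQ _ h)

theorem Forced.four_le (h : Forced T P) (j : Fin m) : 4 ≤ (offsets T P (.y j)).card := by
  obtain ⟨h3, h8⟩ := h.y j
  obtain ⟨a, ha, h1⟩ : ∃ a, a ∈ offsets T P (.y j) ∧ (a = 1 ∨ a = 2) := by
    rcases h.y_fst j with h | h
    · exact ⟨1, h, .inl rfl⟩
    · exact ⟨2, h, .inr rfl⟩
  obtain ⟨b, hb, h2⟩ : ∃ b, b ∈ offsets T P (.y j) ∧ (b = 5 ∨ b = 6) := by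
    rcases h.y_snd j with h | h
    · exact ⟨5, h, .inl rfl⟩
    · exact ⟨6, h, .inr rfl⟩
  have hsub : ({a, 3, b, 8} : Finset ℕ) ⊆ offsets T P (.y j) := by
    simp [Finset.insert_subset_iff, *]
  refine le_trans ?_ (Finset.card_le_card hsub)
  rcases h1 with rfl | rfl <;> rcases h2 with rfl | rfl <;> decide

theorem Forced.card_le (h : Forced T P) :
    4 * n + 6 * m + (Finset.univ.filter fun i => 1 ∈ offsets T P (.x i)).card +
      ∑ j, ((offsets T P (.y j)).card - 4) ≤ P.card := by
  let f : Fin n ⊕ Fin m ⊕ Fin n ⊕ Fin m → Block n m :=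
    Sum.elim .pVert (Sum.elim .pEdge (Sum.elim .x .y))
  have hf : Function.Injective f := by
    rintro (_ | _ | _ | _) (_ | _ | _ | _) h <;> simp_all [f]
  have key := sum_card_offsets_le (T := T) (P := P) hf
  simp only [Fintype.sum_sum_type, f, Sum.elim_inl, Sum.elim_inr] at key
  have e1 : ∑ i : Fin n, 2 ≤ ∑ i, (offsets T P (.pVert i)).card :=
    Finset.sum_le_sum fun i _ => by
      have : ({0, 1} : Finset ℕ) ⊆ offsets T P (.pVert i) := by
        simp [Finset.insert_subset_iff, h.pVert i]
      exact Finset.card_le_card this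
  have e2 : ∑ j : Fin m, 2 ≤ ∑ j, (offsets T P (.pEdge j)).card :=
    Finset.sum_le_sum fun i _ => by
      have : ({0, 1} : Finset ℕ) ⊆ offsets T P (.pEdge i) := by
        simp [Finset.insert_subset_iff, h.pEdge i]
      exact Finset.card_le_card this
  have e3 : ∑ i : Fin n, (2 + if 1 ∈ offsets T P (.x i) then 1 else 0) ≤
      ∑ i, (offsets T P (.x i)).card :=
    Finset.sum_le_sum fun i _ => by
      obtain ⟨h0, h2⟩ := h.x i
      split_ifs with h1
      · have : ({0, 1, 2} : Finset ℕ) ⊆ offsets T P (.x i) := by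
          simp [Finset.insert_subset_iff, *]
        exact Finset.card_le_card this
      · have : ({0, 2} : Finset ℕ) ⊆ offsets T P (.x i) := by
          simp [Finset.insert_subset_iff, *]
        exact Finset.card_le_card this
  have e4 : ∑ j : Fin m, (4 + ((offsets T P (.y j)).card - 4)) =
      ∑ j, (offsets T P (.y j)).card :=
    Finset.sum_congr rfl fun j _ => by
      have := h.four_le j
      omega
  simp only [Finset.sum_add_distrib, Finset.sum_const, Finset.card_univ, Fintype.card_fin,
    smul_eq_mul, Finset.sum_boole, Nat.cast_id] at e1 e2 e3 e4
  omega

end Tag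

/-! ### Forced phrase ends -/

namespace GraphNumbering

variable {V : Type*} {G : SimpleGraph V} {n m : ℕ} (N : GraphNumbering G n m) {ℓ c : ℕ}

theorem tag_alpha_of_lt (hc : 1 ≤ c) {p : ℕ} (hp : p < (N.strAlpha ℓ 1).length) :
    (Tag.alpha n m ℓ c)[p]? = (Tag.alpha n m ℓ 1)[p]? := by
  have h : Tag.alpha n m ℓ 1 <+: Tag.alpha n m ℓ c := by
    induction c, hc using Nat.le_induction with
    | base => exact List.prefix_rfl
    | succ c hc ih =>
      obtain ⟨c, rfl⟩ : ∃ e, c = e + 1 := ⟨c - 1, by omega⟩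
      exact ih.trans (List.prefix_append _ _)
  simpa using OccursAt.of_prefix h p (by rwa [N.length_alpha])

/-- Within the first copy of `α^(1)` each tag has only one position. -/
theorem tag_inj (hc : 1 ≤ c) {p u : ℕ} {t : Tag n m ℓ} (hp : p < (N.strAlpha ℓ 1).length)
    (hu : u < (N.strAlpha ℓ 1).length) (h : (Tag.alpha n m ℓ c)[p]? = some t)
    (h' : (Tag.alpha n m ℓ c)[u]? = some t) : p = u := by
  rw [N.tag_alpha_of_lt hc hp] at h
  rw [N.tag_alpha_of_lt hc hu] at h'
  exact (List.getElem?_inj (by rwa [N.length_alpha]) Tag.nodup_alpha_one).1 (h.trans h'.symm)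

/-- A tag in a prefix `U` of `α^(1)` has a position all of whose predecessors carry tags of `U`. -/
theorem exists_pos_of_prefix (hc : 1 ≤ c) {U : List (Tag n m ℓ)} (hU : U <+: Tag.alpha n m ℓ 1)
    {t : Tag n m ℓ} (ht : t ∈ U) :
    ∃ p < (N.strAlpha ℓ 1).length, (Tag.alpha n m ℓ c)[p]? = some t ∧
      ∀ u < p, ∀ t', (Tag.alpha n m ℓ c)[u]? = some t' → t' ∈ U := by
  obtain ⟨p, hp⟩ := List.mem_iff_getElem?.1 ht
  have hlen := hU.length_le
  rw [N.length_alpha] at hlen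
  have hpU := (List.getElem?_eq_some_iff.1 hp).1
  have key : ∀ u < U.length, (Tag.alpha n m ℓ c)[u]? = U[u]? := fun u hu => by
    rw [N.tag_alpha_of_lt hc (by omega)]
    simpa using OccursAt.of_prefix hU u hu
  refine ⟨p, by omega, by rw [key p hpU, hp], fun u hu t' h => ?_⟩
  rw [key u (by omega)] at h
  exact List.mem_of_getElem? h

theorem getElem?_strAlpha_of_tag {p : ℕ} {t : Tag n m ℓ} (h : (Tag.alpha n m ℓ c)[p]? = some t) :
    (N.strAlpha ℓ c)[p]? = some (N.letter t) := by
  rw [getElem?_strAlpha, h, Option.map_some]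

theorem lt_length_of_tag {p : ℕ} {t : Tag n m ℓ} (h : (Tag.alpha n m ℓ c)[p]? = some t) :
    p < (N.strAlpha ℓ c).length := by
  rw [← N.length_alpha]
  exact (List.getElem?_eq_some_iff.1 h).1

theorem length_one_le (hc : 1 ≤ c) : (N.strAlpha ℓ 1).length ≤ (N.strAlpha ℓ c).length :=
  (N.strAlpha_prefix le_rfl hc).length_le

/-- A vertex letter and the following edge letter of the first copy of `Y` are not copied
together, because the pair has no earlier occurrence. -/
theorem mem_ends_of_vert_edge (φ : LZParsing (N.strAlpha ℓ c)) (hc : 1 ≤ c) {p : ℕ} {i : Fin n}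
    {j : Fin m} (hp : p + 1 < (N.strAlpha ℓ 1).length)
    (h : (N.strAlpha ℓ c)[p]? = some (.vert i))
    (h' : (N.strAlpha ℓ c)[p + 1]? = some (.edge j)) :
    p ∈ φ.ends ∨ p + 1 ∈ φ.ends := by
  by_contra! h1
  have hlen := N.length_one_le (ℓ := ℓ) hc
  obtain ⟨a, ha⟩ := φ.exists_forall_inPrefix (y := p) (L := 2) two_pos (by omega) (by
    intro r hr
    interval_cases r
    · exact h1.1
    · exact h1.2)
  have ha0 := ha 0 two_pos
  rw [add_zero] at ha0
  have hlt := φ.sourcePos_lt ha0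
  have e1 := φ.getElem?_sourcePos ha0
  have e2 := φ.getElem?_sourcePos_add ha0 (ha 1 one_lt_two)
  have hne := N.fst_ne_snd j
  rcases N.tag_of_vert_edge h h' with ⟨t1, rfl⟩ | ⟨t1, rfl⟩ <;>
  rcases N.tag_of_vert_edge (e1.trans h) (e2.trans h') with ⟨t2, h2⟩ | ⟨t2, h2⟩
  · have := N.tag_inj hc (by omega) (by omega) t1 t2
    omega
  · exact hne h2.symm
  · exact hne h2
  · have := N.tag_inj hc (by omega) (by omega) t1 t2
    omega

/-- The phrase ends in the first copy of `α^(1)`: the letters that occur there for the first time,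
and one of `v`, `e_j` in each half of a block `Y_j`. -/
theorem forced_ends (φ : LZParsing (N.strAlpha ℓ c)) (hc : 1 ≤ c) :
    Tag.Forced (Tag.alpha n m ℓ c)
      (φ.ends.filter fun p => p < (N.strAlpha ℓ 1).length) := by
  have hlen := N.length_one_le (ℓ := ℓ) hc
  -- a tag whose letter occurs for the first time there
  have first : ∀ (U : List (Tag n m ℓ)) (b : Block n m) (r : ℕ), U <+: Tag.alpha n m ℓ 1 →
      .base b r ∈ U → r < b.len →
      (∀ p u, u < p → p < (N.strAlpha ℓ 1).length → (Tag.alpha n m ℓ c)[p]? = some (.base b r) →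
        (N.strAlpha ℓ c)[u]? = some (N.letter (.base b r)) →
        ∃ t', (Tag.alpha n m ℓ c)[u]? = some t' ∧ (t' = .base b r ∨ t' ∉ U)) →
      r ∈ Tag.offsets (Tag.alpha n m ℓ c)
        (φ.ends.filter fun p => p < (N.strAlpha ℓ 1).length) b := by
    intro U b r hU hmem hr h
    obtain ⟨p, hp, ht, hpre⟩ := N.exists_pos_of_prefix hc hU hmem
    refine Tag.mem_offsets_of_tag (p := p) (Finset.mem_filter.2 ⟨?_, hp⟩) ht
    refine φ.mem_ends_of_first (by omega) fun u hu he => ?_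
    rw [N.getElem?_strAlpha_of_tag ht] at he
    obtain ⟨t', ht', rfl | h'⟩ := h p u hu hp ht he
    · have := N.tag_inj hc hp (by omega) ht ht'
      omega
    · exact h' (hpre u hu t' ht')
  have preP : Tag.listP n m ℓ <+: Tag.alpha n m ℓ 1 :=
    (List.prefix_append _ _).trans (List.prefix_append _ _)
  have preX : Tag.listP n m ℓ ++ Tag.listX n m ℓ <+: Tag.alpha n m ℓ 1 := List.prefix_append _ _
  refine ⟨fun i => ⟨?_, ?_⟩, fun j => ⟨?_, ?_⟩, fun i => ⟨?_, ?_⟩, fun j => ⟨?_, ?_⟩,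
    fun j => ?_, fun j => ?_⟩
  · refine first _ _ _ preP (Tag.base_mem_listP.2 (by simp [Block.len])) (by simp [Block.len]) ?_
    intro p u _ _ _ h
    rcases N.tag_of_vert h with h | h | ⟨j, h, -⟩ | ⟨j, h, -⟩
    · exact ⟨_, h, .inl rfl⟩
    all_goals exact ⟨_, h, .inr (by simp [Tag.base_mem_listP])⟩
  · refine first _ _ _ List.prefix_rfl (Tag.base_mem_alpha_one (by simp [Block.len]))
      (by simp [Block.len]) ?_
    intro p u _ _ _ h
    exact ⟨_, N.tag_of_sepP_left h, .inl rfl⟩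
  · refine first _ _ _ preP (Tag.base_mem_listP.2 (by simp [Block.len])) (by simp [Block.len]) ?_
    intro p u _ _ _ h
    rcases N.tag_of_edge h with h | h | h
    · exact ⟨_, h, .inl rfl⟩
    all_goals exact ⟨_, h, .inr (by simp [Tag.base_mem_listP])⟩
  · refine first _ _ _ List.prefix_rfl (Tag.base_mem_alpha_one (by simp [Block.len]))
      (by simp [Block.len]) ?_
    intro p u _ _ _ h
    exact ⟨_, N.tag_of_sepP_right h, .inl rfl⟩
  · refine first _ _ _ preX (List.mem_append_right _ (Tag.base_mem_listX.2 (by simp [Block.len])))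
      (by simp [Block.len]) ?_
    intro p u _ _ _ h
    rcases N.tag_of_vert' h with h | ⟨j, h, -⟩ | ⟨j, h, -⟩
    · exact ⟨_, h, .inl rfl⟩
    all_goals exact ⟨_, h, .inr (by simp [Tag.base_mem_listP, Tag.base_mem_listX])⟩
  · refine first _ _ _ List.prefix_rfl (Tag.base_mem_alpha_one (by simp [Block.len]))
      (by simp [Block.len]) ?_
    intro p u _ _ _ h
    exact ⟨_, N.tag_of_sepV h, .inl rfl⟩
  · refine first _ _ _ List.prefix_rfl (Tag.base_mem_alpha_one (by simp [Block.len]))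
      (by simp [Block.len]) ?_
    intro p u hup hp ht h
    rcases N.tag_of_dollar h with h | h
    · exact ⟨_, h, .inl rfl⟩
    · -- the first `$_j` of the same block would be further left
      have h1 := (Tag.coherent_alpha c _ _ _ h).2.2 3 (by simp [Block.len])
      have h2 := (Tag.coherent_alpha c _ _ _ h).1
      have := N.tag_inj hc (by omega) (by omega) ht h1
      omega
  · refine first _ _ _ List.prefix_rfl (Tag.base_mem_alpha_one (by simp [Block.len]))
      (by simp [Block.len]) ?_
    intro p u _ _ _ h
    exact ⟨_, N.tag_of_sepE h, .inl rfl⟩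
  · obtain ⟨p, hp, ht, -⟩ := N.exists_pos_of_prefix hc List.prefix_rfl
      (Tag.base_mem_alpha_one (ℓ := ℓ) (b := .y j) (r := 2) (by simp [Block.len]))
    obtain ⟨h1, -, h2⟩ := Tag.coherent_alpha c _ _ _ ht
    have ht1 := h2 1 (by simp [Block.len])
    have e : p - 2 + 1 + 1 = p := by omega
    rcases N.mem_ends_of_vert_edge φ hc (p := p - 2 + 1) (by omega) (N.getElem?_strAlpha_of_tag ht1)
      (by rw [e]; exact N.getElem?_strAlpha_of_tag ht) with h3 | h3
    · exact .inl (Tag.mem_offsets_of_tag (Finset.mem_filter.2 ⟨h3, by omega⟩) ht1)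
    · rw [e] at h3
      exact .inr (Tag.mem_offsets_of_tag (Finset.mem_filter.2 ⟨h3, by omega⟩) ht)
  · obtain ⟨p, hp, ht, -⟩ := N.exists_pos_of_prefix hc List.prefix_rfl
      (Tag.base_mem_alpha_one (ℓ := ℓ) (b := .y j) (r := 6) (by simp [Block.len]))
    obtain ⟨h1, -, h2⟩ := Tag.coherent_alpha c _ _ _ ht
    have ht1 := h2 5 (by simp [Block.len])
    have e : p - 6 + 5 + 1 = p := by omega
    rcases N.mem_ends_of_vert_edge φ hc (p := p - 6 + 5) (by omega) (N.getElem?_strAlpha_of_tag ht1)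
      (by rw [e]; exact N.getElem?_strAlpha_of_tag ht) with h3 | h3
    · exact .inl (Tag.mem_offsets_of_tag (Finset.mem_filter.2 ⟨h3, by omega⟩) ht1)
    · rw [e] at h3
      exact .inr (Tag.mem_offsets_of_tag (Finset.mem_filter.2 ⟨h3, by omega⟩) ht)

open Classical in
/-- The first occurrences of the separators `#^(i)_γ`. -/
noncomputable def firstSeps (N : GraphNumbering G n m) (ℓ c : ℕ) : Finset ℕ :=
  {p ∈ Finset.range (N.strAlpha ℓ c).length |
    (∃ i γ, (N.strAlpha ℓ c)[p]? = some (.sepB i γ)) ∧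
      ∀ u < p, (N.strAlpha ℓ c)[u]? ≠ (N.strAlpha ℓ c)[p]?}

theorem mem_firstSeps {p : ℕ} : p ∈ N.firstSeps ℓ c ↔ p < (N.strAlpha ℓ c).length ∧
    (∃ i γ, (N.strAlpha ℓ c)[p]? = some (.sepB i γ)) ∧
      ∀ u < p, (N.strAlpha ℓ c)[u]? ≠ (N.strAlpha ℓ c)[p]? := by
  simp [firstSeps]

theorem firstSeps_subset_ends (φ : LZParsing (N.strAlpha ℓ c)) : N.firstSeps ℓ c ⊆ φ.ends := by
  intro p hp
  obtain ⟨h1, -, h2⟩ := N.mem_firstSeps.1 hp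
  exact φ.mem_ends_of_first h1 h2

theorem notMem_firstSeps_of_tag {p : ℕ} {b : Block n m} {r : ℕ}
    (h : (Tag.alpha n m ℓ c)[p]? = some (.base b r)) : p ∉ N.firstSeps ℓ c := by
  intro hp
  obtain ⟨-, ⟨i, γ, h1⟩, -⟩ := N.mem_firstSeps.1 hp
  have := N.tag_of_sepB h1
  simp [h] at this

theorem notMem_firstSeps_of_lt (hc : 1 ≤ c) {p : ℕ} (hp : p < (N.strAlpha ℓ 1).length) :
    p ∉ N.firstSeps ℓ c := by
  intro h
  obtain ⟨-, ⟨i, γ, h1⟩, -⟩ := N.mem_firstSeps.1 h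
  have := N.tag_of_sepB h1
  rw [N.tag_alpha_of_lt hc hp] at this
  exact Tag.sep_notMem_alpha_one i γ (List.mem_of_getElem? this)

theorem le_card_firstSeps : ℓ * (c - 1) ≤ (N.firstSeps ℓ c).card := by
  classical
  have h : ∀ x : Fin ℓ × Fin (c - 1), ∃ p, p ∈ N.firstSeps ℓ c ∧
      (N.strAlpha ℓ c)[p]? = some (.sepB (x.2 + 1) x.1) := by
    intro x
    have hex := List.mem_iff_getElem?.1
      (N.sepB_mem (i := c) (i' := x.2 + 1) x.1 (by omega) (by omega))
    refine ⟨Nat.find hex, N.mem_firstSeps.2 ⟨?_, ⟨_, _, Nat.find_spec hex⟩, fun u hu he => ?_⟩,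
      Nat.find_spec hex⟩
    · exact (List.getElem?_eq_some_iff.1 (Nat.find_spec hex)).1
    · exact Nat.find_min hex hu (he.trans (Nat.find_spec hex))
  choose f hf hf' using h
  have hinj : Function.Injective f := by
    intro x y hxy
    have := (hf' x).symm.trans (hxy ▸ hf' y)
    simp only [Option.some.injEq, Letter.sepB.injEq, Nat.add_right_cancel_iff] at this
    exact Prod.ext this.2 (Fin.ext this.1)
  have := Finset.card_le_card_of_injOn (s := Finset.univ) (t := N.firstSeps ℓ c) f
    (fun x _ => hf x) hinj.injOn
  simpa using this

/-- The phrase ends that are not first occurrences of separators. -/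
noncomputable def innerEnds (N : GraphNumbering G n m) (φ : LZParsing (N.strAlpha ℓ c)) :
    Finset ℕ :=
  φ.ends \ N.firstSeps ℓ c

theorem card_innerEnds_le (φ : LZParsing (N.strAlpha ℓ c)) {t : ℕ}
    (h : φ.size ≤ t + ℓ * (c - 1)) : (N.innerEnds φ).card ≤ t := by
  rw [innerEnds, Finset.card_sdiff_of_subset (N.firstSeps_subset_ends φ), φ.card_ends]
  have := N.le_card_firstSeps (ℓ := ℓ) (c := c)
  omega

theorem first_subset_innerEnds (φ : LZParsing (N.strAlpha ℓ c)) (hc : 1 ≤ c) :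
    (φ.ends.filter fun p => p < (N.strAlpha ℓ 1).length) ⊆ N.innerEnds φ := by
  intro p hp
  obtain ⟨h1, h2⟩ := Finset.mem_filter.1 hp
  exact Finset.mem_sdiff.2 ⟨h1, N.notMem_firstSeps_of_lt hc h2⟩

theorem forced_innerEnds (φ : LZParsing (N.strAlpha ℓ c)) (hc : 1 ≤ c) :
    Tag.Forced (Tag.alpha n m ℓ c) (N.innerEnds φ) :=
  (N.forced_ends φ hc).mono (N.first_subset_innerEnds φ hc)

theorem mem_offsets_of_mem_ends (φ : LZParsing (N.strAlpha ℓ c)) {p : ℕ} {b : Block n m} {r : ℕ}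
    (hp : p ∈ φ.ends) (h : (Tag.alpha n m ℓ c)[p]? = some (.base b r)) :
    r ∈ Tag.offsets (Tag.alpha n m ℓ c) (N.innerEnds φ) b :=
  Tag.mem_offsets_of_tag (Finset.mem_sdiff.2 ⟨hp, N.notMem_firstSeps_of_tag h⟩) h

/-! ### Copies of `α^(i)` with small hop-numbers -/

/-- Less than `ℓ` phrase ends are not forced, so one of the `ℓ` blocks of an occurrence of
`α^(i + 1)` contains no phrase end; its sources form an occurrence of `α^(i)`. -/
theorem exists_occursAt_hop_le_of_succ (φ : LZParsing (N.strAlpha ℓ c)) (hn : 0 < n) {k : ℕ}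
    (hℓ : k < ℓ) (hsize : φ.size ≤ 4 * n + 6 * m + k + ℓ * (c - 1)) {i x : ℕ} (hi : 1 ≤ i)
    (hic : i < c) (hx : OccursAt (N.strAlpha ℓ (i + 1)) (N.strAlpha ℓ c) x)
    (hhop : ∀ r < (N.strAlpha ℓ (i + 1)).length, φ.hop (x + r) ≤ i + 1) :
    ∃ x', OccursAt (N.strAlpha ℓ i) (N.strAlpha ℓ c) x' ∧
      ∀ r < (N.strAlpha ℓ i).length, φ.hop (x' + r) ≤ i := by
  classical
  have hLpos := N.length_strAlpha_pos (ℓ := ℓ) hn hi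
  have hlen := N.length_strAlpha_succ (ℓ := ℓ) hi
  have hL1 := N.length_one_le (ℓ := ℓ) hi
  have hℓ0 : 0 < ℓ := by omega
  -- the blocks lie inside the occurrence of `α^(i + 1)`
  have hin : ∀ k' < ℓ, ∀ r < (N.strAlpha ℓ i).length,
      N.blockStart ℓ i k' + r < (N.strAlpha ℓ (i + 1)).length := by
    intro k' hk' r hr
    have := Nat.mul_le_mul_right ((N.strAlpha ℓ i).length + 1) (Nat.succ_le_of_lt hk')
    rw [Nat.succ_mul] at this
    rw [blockStart]
    omega
  have hblock : ∀ k' < ℓ, OccursAt (N.strAlpha ℓ i) (N.strAlpha ℓ c)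
      (x + N.blockStart ℓ i k') := by
    intro k' hk' r hr
    rw [add_assoc, hx _ (hin k' hk' r hr), N.occursAt_blockStart hi hk' r hr]
  obtain ⟨k', hk', hfree⟩ : ∃ k' < ℓ, ∀ r < (N.strAlpha ℓ i).length,
      x + N.blockStart ℓ i k' + r ∉ φ.ends := by
    by_contra! h
    have h' : ∀ k' : Fin ℓ, ∃ r, r < (N.strAlpha ℓ i).length ∧
        x + N.blockStart ℓ i k' + r ∈ φ.ends := fun k' => h k' k'.2
    choose f hf hf' using h'
    have hinj : Function.Injective fun k' : Fin ℓ => x + N.blockStart ℓ i k' + f k' := by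
      intro a b hab
      have key : ∀ a b : Fin ℓ, x + N.blockStart ℓ i a + f a = x + N.blockStart ℓ i b + f b →
          ¬ a < b := by
        intro a b hab h3
        have h1 := hf a
        have := Nat.mul_le_mul_right ((N.strAlpha ℓ i).length + 1) (Nat.succ_le_of_lt h3)
        rw [Nat.succ_mul] at this
        simp only [blockStart] at hab
        omega
      exact le_antisymm (not_lt.1 (key b a hab.symm)) (not_lt.1 (key a b hab))
    have hB : Finset.univ.image (fun k' : Fin ℓ => x + N.blockStart ℓ i k' + f k') ⊆
        N.innerEnds φ \ (φ.ends.filter fun p => p < (N.strAlpha ℓ 1).length) := by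
      intro p hp
      obtain ⟨k', -, rfl⟩ := Finset.mem_image.1 hp
      refine Finset.mem_sdiff.2 ⟨Finset.mem_sdiff.2 ⟨hf' k', fun h1 => ?_⟩, fun h1 => ?_⟩
      · -- the prefix `α^(i)` of the occurrence contains the same letter
        obtain ⟨-, -, h2⟩ := N.mem_firstSeps.1 h1
        refine h2 (x + f k') ?_ ?_
        · simp only [blockStart]
          omega
        · rw [hblock k' k'.2 _ (hf k'), hx _ (by have := hf k'; omega)]
          have := OccursAt.of_prefix (N.strAlpha_prefix (ℓ := ℓ) hi (Nat.le_succ i)) _ (hf k')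
          rwa [zero_add] at this
      · have := (Finset.mem_filter.1 h1).2
        simp only [blockStart] at this
        omega
    have h1 := Finset.card_le_card hB
    rw [Finset.card_image_of_injective _ hinj, Finset.card_univ, Fintype.card_fin,
      Finset.card_sdiff_of_subset (N.first_subset_innerEnds φ (by omega))] at h1
    have h2 := (N.forced_ends φ (by omega)).card_le
    have h3 := N.card_innerEnds_le φ hsize
    omega
  have hy := hblock k' hk'
  obtain ⟨j, hj⟩ := φ.exists_forall_inPrefix hLpos (by
    have h1 := hy ((N.strAlpha ℓ i).length - 1) (by omega)
    rw [List.getElem?_eq_getElem (l := N.strAlpha ℓ i) (by omega)] at h1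
    have := (List.getElem?_eq_some_iff.1 h1).1
    omega) hfree
  have hcont := fun r hr => φ.sourcePos_add hy hj
    (fun z b hz hb => N.not_overlap hn hℓ0 hi hz hb)
    (fun a d hd had hsq => by
      obtain ⟨j, hj1, hjd, hocc⟩ := N.square_strAlpha hn hℓ0 (by omega) (by omega) had hsq
      have hij : i ≤ j := by
        by_contra! hij
        have := N.length_strAlpha_lt hℓ0 hj1 hij
        omega
      intro r hr
      have hpre := N.strAlpha_prefix (ℓ := ℓ) hi hij
      rw [hocc r (hr.trans_le hpre.length_le)]
      simpa using OccursAt.of_prefix hpre r hr) (r := r) hr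
  refine ⟨φ.sourcePos (x + N.blockStart ℓ i k') j, fun r hr => ?_, fun r hr => ?_⟩
  · rw [← hcont r hr, φ.getElem?_sourcePos (hj r hr), hy r hr]
  · have h1 := hhop _ (hin k' hk' r hr)
    rw [← add_assoc, φ.hop_of_inPrefix (hj r hr), hcont r hr] at h1
    omega

/-- Some occurrence of `α^(1)` has hop-numbers at most one. -/
theorem exists_occursAt_hop_le_one (φ : LZParsing (N.strAlpha ℓ c)) (hn : 0 < n) (hc : 1 ≤ c)
    {k : ℕ} (hℓ : k < ℓ) (hφ : φ.IsBLZ c)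
    (hsize : φ.size ≤ 4 * n + 6 * m + k + ℓ * (c - 1)) :
    ∃ x, OccursAt (N.strAlpha ℓ 1) (N.strAlpha ℓ c) x ∧
      ∀ r < (N.strAlpha ℓ 1).length, φ.hop (x + r) ≤ 1 := by
  refine Nat.decreasingInduction' (m := 1) (n := c)
    (P := fun i => ∃ x, OccursAt (N.strAlpha ℓ i) (N.strAlpha ℓ c) x ∧
      ∀ r < (N.strAlpha ℓ i).length, φ.hop (x + r) ≤ i) ?_ hc ?_
  · rintro i hic hi ⟨x, hx, hhop⟩
    exact N.exists_occursAt_hop_le_of_succ φ hn hℓ hsize hi hic hx hhop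
  · exact ⟨0, OccursAt.of_prefix List.prefix_rfl, fun r hr => by
      rw [zero_add]; exact φ.hop_le hφ hr⟩

end GraphNumbering

/-! ### From a parsing to a vertex cover -/

namespace GraphNumbering

variable {V : Type*} {G : SimpleGraph V} {n m : ℕ} (N : GraphNumbering G n m) {ℓ c : ℕ}

/-- If `v_i' v_i` is copied within one phrase with hop-numbers at most one, then phrases end at
both letters of some `v_i' v_i` in `X_i` or in a block of `Y`. -/
theorem exists_vert_ends (φ : LZParsing (N.strAlpha ℓ c)) {p : ℕ} {i : Fin n}
    (h0 : p ∉ φ.ends) (h1 : p + 1 ∉ φ.ends) (hh0 : φ.hop p ≤ 1) (hh1 : φ.hop (p + 1) ≤ 1)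
    (hs0 : (N.strAlpha ℓ c)[p]? = some (.vert' i))
    (hs1 : (N.strAlpha ℓ c)[p + 1]? = some (.vert i)) :
    1 ∈ Tag.offsets (Tag.alpha n m ℓ c) (N.innerEnds φ) (.x i) ∨
    (∃ j, N.fst j = i ∧ 0 ∈ Tag.offsets (Tag.alpha n m ℓ c) (N.innerEnds φ) (.y j) ∧
      1 ∈ Tag.offsets (Tag.alpha n m ℓ c) (N.innerEnds φ) (.y j)) ∨
    (∃ j, N.snd j = i ∧ 4 ∈ Tag.offsets (Tag.alpha n m ℓ c) (N.innerEnds φ) (.y j) ∧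
      5 ∈ Tag.offsets (Tag.alpha n m ℓ c) (N.innerEnds φ) (.y j)) := by
  have hlen := (List.getElem?_eq_some_iff.1 hs1).1
  obtain ⟨a, ha⟩ := φ.exists_forall_inPrefix (y := p) (L := 2) two_pos (by omega) (by
    intro r hr
    interval_cases r
    · exact h0
    · exact h1)
  have ha0 : φ.InPrefix p a := ha 0 two_pos
  have ha1 := ha 1 one_lt_two
  have hlt0 := φ.sourcePos_lt ha0
  have hlt1 := φ.sourcePos_lt ha1
  rw [φ.hop_of_inPrefix ha0] at hh0
  rw [φ.hop_of_inPrefix ha1] at hh1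
  have he0 := φ.mem_ends_of_hop_eq_zero (p := φ.sourcePos p a) (by omega) (by omega)
  have he1 := φ.mem_ends_of_hop_eq_zero (p := φ.sourcePos (p + 1) a) (by omega) (by omega)
  have e0 := (φ.getElem?_sourcePos ha0).trans hs0
  have e01 := (φ.getElem?_sourcePos_add ha0 ha1).trans hs1
  have e1 := (φ.getElem?_sourcePos ha1).trans hs1
  have hsucc := φ.sourcePos_succ ha0
  -- where the sources wrap around, the letter after the copied `v_i` identifies its block
  have wrap : φ.sourcePos (p + 1) a = φ.src a ∧ φ.sourcePos p a + 1 = φ.cut a.castSucc →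
      (N.strAlpha ℓ c)[φ.sourcePos (p + 1) a + 1]? = (N.strAlpha ℓ c)[φ.sourcePos p a + 2]? := by
    rintro ⟨w1, w2⟩
    have hne : φ.cut a.castSucc ≠ p := by
      rintro h
      rw [w2, h, hs0] at e01
      simp at e01
    have hle := ha0.1
    have hs := φ.src_lt_of_inPrefix ha0
    have := φ.getElem?_period (j := a) (q := φ.src a + 1) (by omega)
      ⟨by omega, by have := ha1.2; omega⟩
    rw [w1, this]
    congr 1
    omega
  rcases N.tag_of_vert' e0 with t0 | ⟨j, t0, hj⟩ | ⟨j, t0, hj⟩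
  · left
    rcases hsucc with h | h
    · refine N.mem_offsets_of_mem_ends φ he1 ?_
      rw [h]
      exact (Tag.coherent_alpha c _ _ _ t0).2.2 1 (by simp [Block.len])
    · have h2 := (wrap h).trans (N.getElem?_strAlpha_of_block t0 2 (by simp [Block.len]))
      have h3 := (Tag.coherent_alpha c _ _ _ (N.tag_of_sepV h2)).2.2 1 (by simp [Block.len])
      have h4 := (Tag.coherent_alpha c _ _ _ (N.tag_of_sepV h2)).1
      refine N.mem_offsets_of_mem_ends φ he1 ?_
      rwa [show φ.sourcePos (p + 1) a + 1 - 2 + 1 = φ.sourcePos (p + 1) a by omega] at h3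
  · right; left
    refine ⟨j, hj, N.mem_offsets_of_mem_ends φ he0 t0, ?_⟩
    refine N.mem_offsets_of_mem_ends φ he1 ?_
    rcases hsucc with h | h
    · rw [h]
      exact (Tag.coherent_alpha c _ _ _ t0).2.2 1 (by simp [Block.len])
    · have h2 := (wrap h).trans (N.getElem?_strAlpha_of_block t0 2 (by simp [Block.len]))
      rcases N.tag_of_vert_edge e1 h2 with ⟨h3, -⟩ | ⟨-, h3⟩
      · exact h3
      · exact absurd (hj.trans h3.symm) (N.fst_ne_snd j)
  · right; right
    refine ⟨j, hj, N.mem_offsets_of_mem_ends φ he0 t0, ?_⟩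
    refine N.mem_offsets_of_mem_ends φ he1 ?_
    have h4 := (Tag.coherent_alpha c _ _ _ t0).1
    rcases hsucc with h | h
    · have h5 := (Tag.coherent_alpha c _ _ _ t0).2.2 5 (by simp [Block.len])
      rwa [show φ.sourcePos p a - 4 + 5 = φ.sourcePos (p + 1) a by omega] at h5
    · have h6 := N.getElem?_strAlpha_of_block t0 6 (by simp [Block.len])
      rw [show φ.sourcePos p a - 4 + 6 = φ.sourcePos p a + 2 by omega] at h6
      rcases N.tag_of_vert_edge e1 ((wrap h).trans h6) with ⟨-, h3⟩ | ⟨h3, -⟩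
      · exact absurd (h3.trans hj.symm) (N.fst_ne_snd j)
      · exact h3

/-- The endpoints of `e_j` that are put into the vertex cover because of the phrase ends at the
offsets `S` of the block `Y_j`: one for each phrase end beyond the fourth, up to two. If there is
only one, it is the endpoint that may have phrase ends at both letters of `v' v` in the block. -/
def charged (N : GraphNumbering G n m) (S : Finset ℕ) (j : Fin m) : Finset (Fin n) :=
  if 6 ≤ S.card then {N.fst j, N.snd j}
  else if S.card = 5 then if 0 ∈ S then {N.fst j} else {N.snd j}
  else ∅

theorem card_charged_le (S : Finset ℕ) (j : Fin m) : (N.charged S j).card ≤ S.card - 4 := by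
  unfold charged
  split_ifs with h1 h2 h3
  · exact Finset.card_le_two.trans (by omega)
  · simp [h2]
  · simp [h2]
  · simp

section Cover

variable (φ : LZParsing (N.strAlpha ℓ c))

/-- The vertices `v_i` with a phrase end at a `v_i` in a copy of `X_i`, and the endpoints charged
for the blocks of `Y`. -/
noncomputable def coverOf (N : GraphNumbering G n m) (φ : LZParsing (N.strAlpha ℓ c)) :
    Finset (Fin n) :=
  (Finset.univ.filter fun i => 1 ∈ Tag.offsets (Tag.alpha n m ℓ c) (N.innerEnds φ) (.x i)) ∪
    Finset.univ.biUnion fun j =>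
      N.charged (Tag.offsets (Tag.alpha n m ℓ c) (N.innerEnds φ) (.y j)) j

theorem card_coverOf_le (hc : 1 ≤ c) {k : ℕ}
    (hsize : φ.size ≤ 4 * n + 6 * m + k + ℓ * (c - 1)) : (N.coverOf φ).card ≤ k := by
  have h1 := (N.forced_innerEnds φ hc).card_le
  have h2 := N.card_innerEnds_le φ hsize
  have h3 : (Finset.univ.biUnion fun j =>
      N.charged (Tag.offsets (Tag.alpha n m ℓ c) (N.innerEnds φ) (.y j)) j).card ≤
      ∑ j, ((Tag.offsets (Tag.alpha n m ℓ c) (N.innerEnds φ) (.y j)).card - 4) :=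
    Finset.card_biUnion_le.trans (Finset.sum_le_sum fun j _ => N.card_charged_le _ j)
  have h4 := Finset.card_union_le
    (Finset.univ.filter fun i => 1 ∈ Tag.offsets (Tag.alpha n m ℓ c) (N.innerEnds φ) (.x i))
    (Finset.univ.biUnion fun j =>
      N.charged (Tag.offsets (Tag.alpha n m ℓ c) (N.innerEnds φ) (.y j)) j)
  rw [coverOf]
  omega

variable {φ}

theorem mem_coverOf_of_charged {i : Fin n} {j : Fin m}
    (h : i ∈ N.charged (Tag.offsets (Tag.alpha n m ℓ c) (N.innerEnds φ) (.y j)) j) :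
    i ∈ N.coverOf φ :=
  Finset.mem_union_right _ (Finset.mem_biUnion.2 ⟨j, Finset.mem_univ j, h⟩)

theorem fst_mem_coverOf (hc : 1 ≤ c) {j : Fin m}
    (h0 : 0 ∈ Tag.offsets (Tag.alpha n m ℓ c) (N.innerEnds φ) (.y j))
    (h1 : 1 ∈ Tag.offsets (Tag.alpha n m ℓ c) (N.innerEnds φ) (.y j)) :
    N.fst j ∈ N.coverOf φ := by
  have hF := N.forced_innerEnds φ hc
  refine N.mem_coverOf_of_charged (j := j) ?_
  have h5 : 5 ≤ (Tag.offsets (Tag.alpha n m ℓ c) (N.innerEnds φ) (.y j)).card := by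
    obtain ⟨h3, h8⟩ := hF.y j
    rcases hF.y_snd j with h | h
    · exact Finset.card_le_card (s := {0, 1, 3, 8, 5})
        (t := Tag.offsets (Tag.alpha n m ℓ c) (N.innerEnds φ) (.y j))
        (by simp [Finset.insert_subset_iff, *])
    · exact Finset.card_le_card (s := {0, 1, 3, 8, 6})
        (t := Tag.offsets (Tag.alpha n m ℓ c) (N.innerEnds φ) (.y j))
        (by simp [Finset.insert_subset_iff, *])
  unfold charged
  split_ifs with a1 a2
  · simp
  · simp
  · omega

theorem snd_mem_coverOf (hc : 1 ≤ c) {j : Fin m}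
    (h4 : 4 ∈ Tag.offsets (Tag.alpha n m ℓ c) (N.innerEnds φ) (.y j))
    (h5 : 5 ∈ Tag.offsets (Tag.alpha n m ℓ c) (N.innerEnds φ) (.y j)) :
    N.snd j ∈ N.coverOf φ := by
  have hF := N.forced_innerEnds φ hc
  refine N.mem_coverOf_of_charged (j := j) ?_
  obtain ⟨a, ha, h1⟩ : ∃ a, a ∈ Tag.offsets (Tag.alpha n m ℓ c) (N.innerEnds φ) (.y j) ∧
      (a = 1 ∨ a = 2) := by
    rcases hF.y_fst j with h | h
    · exact ⟨1, h, .inl rfl⟩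
    · exact ⟨2, h, .inr rfl⟩
  obtain ⟨h3, h8⟩ := hF.y j
  have hcard : 5 ≤ (Tag.offsets (Tag.alpha n m ℓ c) (N.innerEnds φ) (.y j)).card := by
    refine le_trans ?_ (Finset.card_le_card (s := {a, 3, 8, 4, 5})
      (by simp [Finset.insert_subset_iff, *]))
    rcases h1 with rfl | rfl <;> decide
  unfold charged
  split_ifs with a1 a2 a3
  · simp
  · have : 6 ≤ (Tag.offsets (Tag.alpha n m ℓ c) (N.innerEnds φ) (.y j)).card := by
      refine le_trans ?_ (Finset.card_le_card (s := {0, a, 3, 8, 4, 5})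
        (by simp [Finset.insert_subset_iff, *]))
      rcases h1 with rfl | rfl <;> decide
    exact absurd this a1
  · simp
  · omega

/-- A block of `Y` with a fifth phrase end in some copy has a charged endpoint. -/
theorem mem_coverOf_of_five {j : Fin m}
    (h : 5 ≤ (Tag.offsets (Tag.alpha n m ℓ c) (N.innerEnds φ) (.y j)).card) :
    N.fst j ∈ N.coverOf φ ∨ N.snd j ∈ N.coverOf φ := by
  by_cases h6 : 6 ≤ (Tag.offsets (Tag.alpha n m ℓ c) (N.innerEnds φ) (.y j)).card
  · exact .inl (N.mem_coverOf_of_charged (j := j) (by simp [charged, h6]))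
  · have h5 : (Tag.offsets (Tag.alpha n m ℓ c) (N.innerEnds φ) (.y j)).card = 5 := by omega
    by_cases h0 : 0 ∈ Tag.offsets (Tag.alpha n m ℓ c) (N.innerEnds φ) (.y j)
    · exact .inl (N.mem_coverOf_of_charged (j := j) (by simp [charged, h5, h0]))
    · exact .inr (N.mem_coverOf_of_charged (j := j) (by simp [charged, h5, h0]))

theorem mem_coverOf_of_vert (hc : 1 ≤ c) {p : ℕ} {i : Fin n}
    (h0 : p ∉ φ.ends) (h1 : p + 1 ∉ φ.ends) (hh0 : φ.hop p ≤ 1) (hh1 : φ.hop (p + 1) ≤ 1)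
    (hs0 : (N.strAlpha ℓ c)[p]? = some (.vert' i))
    (hs1 : (N.strAlpha ℓ c)[p + 1]? = some (.vert i)) : i ∈ N.coverOf φ := by
  rcases N.exists_vert_ends φ h0 h1 hh0 hh1 hs0 hs1 with h | ⟨j, rfl, h2, h3⟩ | ⟨j, rfl, h2, h3⟩
  · exact Finset.mem_union_left _ (Finset.mem_filter.2 ⟨Finset.mem_univ i, h⟩)
  · exact N.fst_mem_coverOf hc h2 h3
  · exact N.snd_mem_coverOf hc h2 h3

/-- In a copy of `α^(1)` with hop-numbers at most one, a block `Y_j` with only four phrase ends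
copies `v' v` for one of its endpoints from phrase ends. -/
theorem fst_or_snd_mem_coverOf (hc : 1 ≤ c) {x : ℕ}
    (hx : OccursAt (N.strAlpha ℓ 1) (N.strAlpha ℓ c) x)
    (hhop : ∀ r < (N.strAlpha ℓ 1).length, φ.hop (x + r) ≤ 1) (j : Fin m) :
    N.fst j ∈ N.coverOf φ ∨ N.snd j ∈ N.coverOf φ := by
  have hF := N.forced_innerEnds φ hc
  by_cases h5 : 5 ≤ (Tag.offsets (Tag.alpha n m ℓ c) (N.innerEnds φ) (.y j)).card
  · exact N.mem_coverOf_of_five h5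
  -- the copy of `Y_j` starts at `x + p`
  obtain ⟨p, hp, hhop'⟩ : ∃ p, (∀ r < 9,
      (Tag.alpha n m ℓ c)[p + r]? = some (.base (.y j) r)) ∧ ∀ r < 9, φ.hop (p + r) ≤ 1 := by
    obtain ⟨q, hq, ht, -⟩ := N.exists_pos_of_prefix (c := 1) le_rfl List.prefix_rfl
      (Tag.base_mem_alpha_one (ℓ := ℓ) (b := .y j) (r := 8) (by simp [Block.len]))
    have h8 := (hx q hq).trans (N.getElem?_strAlpha_of_tag ht)
    have h9 := (Tag.coherent_alpha 1 _ _ _ ht).1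
    have h10 := N.tag_of_sepE h8
    refine ⟨x + q - 8, fun r hr => (Tag.coherent_alpha c _ _ _ h10).2.2 r hr, fun r hr => ?_⟩
    rw [show x + q - 8 + r = x + (q - 8 + r) by omega]
    exact hhop _ (by omega)
  have hnot : ∀ r < 9, r ∉ Tag.offsets (Tag.alpha n m ℓ c) (N.innerEnds φ) (.y j) →
      p + r ∉ φ.ends := fun r hr h h1 => h (N.mem_offsets_of_mem_ends φ h1 (hp r hr))
  have hstr := fun r hr => N.getElem?_strAlpha_of_tag (hp r hr)
  obtain ⟨h3, h8⟩ := hF.y j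
  generalize hS : Tag.offsets (Tag.alpha n m ℓ c) (N.innerEnds φ) (.y j) = S at *
  -- the four phrase ends of the block
  obtain ⟨a, b, ha, hb, hSab⟩ : ∃ a b, (a = 1 ∨ a = 2) ∧ (b = 5 ∨ b = 6) ∧ S = {a, 3, b, 8} := by
    have : ∃ a b, (a = 1 ∨ a = 2) ∧ (b = 5 ∨ b = 6) ∧ a ∈ S ∧ b ∈ S := by
      have h1 := hF.y_fst j
      have h2 := hF.y_snd j
      rw [hS] at h1 h2
      rcases h1 with h1 | h1 <;> rcases h2 with h2 | h2
      · exact ⟨1, 5, by simp [h1, h2]⟩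
      · exact ⟨1, 6, by simp [h1, h2]⟩
      · exact ⟨2, 5, by simp [h1, h2]⟩
      · exact ⟨2, 6, by simp [h1, h2]⟩
    obtain ⟨a, b, ha, hb, haS, hbS⟩ := this
    refine ⟨a, b, ha, hb, (Finset.eq_of_subset_of_card_le
      (by simp [Finset.insert_subset_iff, *]) ?_).symm⟩
    refine (Nat.lt_succ_iff.1 (not_le.1 h5)).trans ?_
    rcases ha with rfl | rfl <;> rcases hb with rfl | rfl <;> decide
  rcases hb with rfl | rfl
  · -- `e_j $_j` is copied, so a phrase ends at the first `e_j` of the block in some copy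
    have h6 : 6 ∉ S := by
      rw [hSab]
      rcases ha with rfl | rfl <;> decide
    have h7 : 7 ∉ S := by
      rw [hSab]
      rcases ha with rfl | rfl <;> decide
    have hl := N.lt_length_of_tag (hp 7 (by norm_num))
    obtain ⟨i, hi⟩ := φ.exists_forall_inPrefix (y := p + 6) (L := 2) two_pos (by omega) (by
      intro r hr
      interval_cases r
      · exact hnot 6 (by norm_num) h6
      · exact hnot 7 (by norm_num) h7)
    have hi0 : φ.InPrefix (p + 6) i := hi 0 two_pos
    have hh := hhop' 6 (by norm_num)
    have hlt := φ.sourcePos_lt hi0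
    rw [φ.hop_of_inPrefix hi0] at hh
    have hend := φ.mem_ends_of_hop_eq_zero (p := φ.sourcePos (p + 6) i) (by omega) (by omega)
    have e0 := (φ.getElem?_sourcePos hi0).trans (hstr 6 (by norm_num))
    have e1 := (φ.getElem?_sourcePos_add hi0 (hi 1 one_lt_two)).trans (hstr 7 (by norm_num))
    have h2 : 2 ∈ S := by
      rcases N.tag_of_edge e0 with t | t | t
      · have := N.getElem?_strAlpha_of_block t 1 (by simp [Block.len])
        rw [Nat.sub_zero, e1] at this
        simp [letter] at this
      · rw [← hS]
        exact N.mem_offsets_of_mem_ends φ hend t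
      · have := N.mem_offsets_of_mem_ends φ hend t
        rw [hS] at this
        exact absurd this h6
    have ha2 : a = 2 := by
      rcases ha with rfl | rfl
      · rw [hSab] at h2
        revert h2
        decide
      · rfl
    subst ha2
    exact .inl (N.mem_coverOf_of_vert hc (hnot 0 (by norm_num) (by rw [hSab]; decide))
      (hnot 1 (by norm_num) (by rw [hSab]; decide)) (hhop' 0 (by norm_num))
      (hhop' 1 (by norm_num)) (hstr 0 (by norm_num)) (hstr 1 (by norm_num)))
  · refine .inr (N.mem_coverOf_of_vert hc (hnot 4 (by norm_num) ?_)
      (hnot 5 (by norm_num) ?_) (hhop' 4 (by norm_num))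
      (hhop' 5 (by norm_num)) (hstr 4 (by norm_num)) (hstr 5 (by norm_num)))
    all_goals
      rw [hSab]
      rcases ha with rfl | rfl <;> decide

end Cover

/-- A parsing of the given size yields a vertex cover of size at most `k`. -/
theorem exists_cover_of_parsing (hn : 0 < n) (hc : 1 ≤ c) {k : ℕ} (hℓ : k < ℓ)
    (φ : LZParsing (N.strAlpha ℓ c)) (hφ : φ.IsBLZ c)
    (hsize : φ.size ≤ 4 * n + 6 * m + k + ℓ * (c - 1)) :
    ∃ C : Finset (Fin n), C.card ≤ k ∧ ∀ j, N.fst j ∈ C ∨ N.snd j ∈ C := by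
  obtain ⟨x, hx, hhop⟩ := N.exists_occursAt_hop_le_one φ hn hc hℓ hφ hsize
  exact ⟨N.coverOf φ, N.card_coverOf_le φ hc hsize, N.fst_or_snd_mem_coverOf hc hx hhop⟩

end GraphNumbering

/-! ### Building parsings phrase by phrase -/

namespace LZParsing

variable {A : Type*} {s : List A}

/-- Append the phrase `u`, with source `a`, to a parsing. -/
def extend (φ : LZParsing s) (u : List A) (hu : u ≠ []) (a : ℕ)
    (h : u.length = 1 ∨ a < s.length ∧ ∀ r, r + 1 < u.length → (s ++ u)[a + r]? = u[r]?) :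
    LZParsing (s ++ u) where
  size := φ.size + 1
  cut := Fin.snoc (α := fun _ => ℕ) φ.cut (s.length + u.length)
  cut_strictMono := by
    rw [Fin.strictMono_iff_lt_succ]
    intro i
    induction i using Fin.lastCases with
    | last =>
      rw [Fin.snoc_castSucc, Fin.succ_last, Fin.snoc_last, φ.cut_last]
      have := List.length_pos_iff.2 hu
      omega
    | cast i =>
      rw [Fin.snoc_castSucc, Fin.succ_castSucc, Fin.snoc_castSucc]
      exact φ.cut_castSucc_lt i
  cut_zero := by
    rw [← Fin.castSucc_zero, Fin.snoc_castSucc, φ.cut_zero]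
  cut_last := by
    rw [Fin.snoc_last, List.length_append]
  src := Fin.snoc (α := fun _ => ℕ) φ.src a
  isLZ := by
    intro i
    induction i using Fin.lastCases with
    | last =>
      rw [Fin.snoc_castSucc, Fin.succ_last, Fin.snoc_last, Fin.snoc_last, φ.cut_last]
      refine h.imp (fun h => by omega) (fun h => ⟨h.1, fun r hr => ?_⟩)
      rw [h.2 r (by omega), List.getElem?_append_right (by omega)]
      congr 1
      omega
    | cast i =>
      rw [Fin.snoc_castSucc, Fin.succ_castSucc, Fin.snoc_castSucc, Fin.snoc_castSucc]
      refine (φ.isLZ i).imp id (fun h => ⟨h.1, fun r hr => ?_⟩)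
      have := φ.cut_le_length i.succ
      rw [List.getElem?_append_left (by omega), List.getElem?_append_left (by omega)]
      exact h.2 r hr

theorem inPrefix_extend {φ : LZParsing s} {u : List A} {hu : u ≠ []} {a : ℕ}
    {h : u.length = 1 ∨ a < s.length ∧ ∀ r, r + 1 < u.length → (s ++ u)[a + r]? = u[r]?}
    {p : ℕ} {j : Fin (φ.extend u hu a h).size} (hp : (φ.extend u hu a h).InPrefix p j) :
    (∃ j', φ.InPrefix p j' ∧ (φ.extend u hu a h).sourcePos p j = φ.sourcePos p j') ∨
    (s.length ≤ p ∧ p + 1 < s.length + u.length ∧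
      (φ.extend u hu a h).sourcePos p j = a + (p - s.length) % (s.length - a)) := by
  simp only [extend, InPrefix, sourcePos] at j hp ⊢
  induction j using Fin.lastCases with
  | last =>
    rw [Fin.snoc_castSucc, Fin.succ_last, Fin.snoc_last, φ.cut_last] at hp
    rw [Fin.snoc_castSucc, Fin.snoc_last, φ.cut_last]
    exact .inr ⟨hp.1, hp.2, rfl⟩
  | cast i =>
    rw [Fin.snoc_castSucc, Fin.succ_castSucc, Fin.snoc_castSucc] at hp
    rw [Fin.snoc_castSucc, Fin.snoc_castSucc]
    exact .inl ⟨i, hp, rfl⟩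

/-- A function that increases from each source to its position bounds the hop-number. -/
theorem hop_le_of_source {φ : LZParsing s} {f : ℕ → ℕ}
    (h : ∀ j p, φ.InPrefix p j → f (φ.sourcePos p j) + 1 ≤ f p) (p : ℕ) : φ.hop p ≤ f p := by
  induction p using Nat.strong_induction_on with
  | _ p ih =>
    by_cases hp : ∃ j, φ.InPrefix p j
    · obtain ⟨j, hj⟩ := hp
      rw [φ.hop_of_inPrefix hj]
      have := ih _ (φ.sourcePos_lt hj)
      have := h j p hj
      omega
    · rw [hop, dif_neg hp]
      exact Nat.zero_le _

end LZParsing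

/-- The string of the letters of `z` has a parsing of size `t` for which the numbers in `z` are
upper bounds of the hop-numbers. -/
def HasParsing {A : Type*} (z : List (A × ℕ)) (t : ℕ) : Prop :=
  ∃ φ : LZParsing (z.map Prod.fst), φ.size = t ∧ ∀ j p, φ.InPrefix p j →
    ((z.map Prod.snd)[φ.sourcePos p j]?).getD 0 + 1 ≤ ((z.map Prod.snd)[p]?).getD 0

namespace HasParsing

variable {A : Type*} {z : List (A × ℕ)} {t : ℕ}

theorem nil : HasParsing ([] : List (A × ℕ)) 0 := by
  refine ⟨⟨0, fun _ => 0, ?_, rfl, rfl, Fin.elim0, fun j => j.elim0⟩, rfl, fun j => j.elim0⟩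
  intro a b h
  exact absurd h (by omega)

/-- A copy of `w` with hop-numbers raised by one. -/
def raise (w : List (A × ℕ)) : List (A × ℕ) :=
  w.map fun x => (x.1, x.2 + 1)

/-- Append a phrase `w x` whose prefix `w` is copied from an infix. -/
theorem append (h : HasParsing z t) {w : List (A × ℕ)} (hw : w <:+: z) (x : A) :
    HasParsing (z ++ (raise w ++ [(x, 0)])) (t + 1) := by
  obtain ⟨φ, rfl, hφ⟩ := h
  obtain ⟨z₁, z₂, rfl⟩ := hw
  have hfst : (raise w ++ [(x, 0)]).map Prod.fst = w.map Prod.fst ++ [x] := by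
    simp [raise]
  have hcond : ((raise w ++ [(x, 0)]).map Prod.fst).length = 1 ∨
      z₁.length < ((z₁ ++ w ++ z₂).map Prod.fst).length ∧
      ∀ r, r + 1 < ((raise w ++ [(x, 0)]).map Prod.fst).length →
        ((z₁ ++ w ++ z₂).map Prod.fst ++ (raise w ++ [(x, 0)]).map Prod.fst)[z₁.length + r]? =
          ((raise w ++ [(x, 0)]).map Prod.fst)[r]? := by
    rw [hfst]
    rcases w with _ | ⟨y, w⟩
    · simp
    · refine .inr ⟨by simp, fun r hr => ?_⟩
      generalize y :: w = w at *
      simp only [List.length_append, List.length_map, List.length_singleton] at hr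
      rw [List.getElem?_append_left (by simp; omega), List.getElem?_append_left (by simp; omega),
        List.map_append, List.map_append, List.getElem?_append_left (by simp; omega),
        List.getElem?_append_right (by simp)]
      simp
  have hne : (raise w ++ [(x, 0)]).map Prod.fst ≠ [] := by simp
  let ψ := φ.extend _ hne _ hcond
  rw [HasParsing, List.map_append]
  refine ⟨ψ, rfl, fun j p hp => ?_⟩
  have hlt := ψ.sourcePos_lt hp
  rw [List.map_append]
  rcases LZParsing.inPrefix_extend hp with ⟨j', h1, h2⟩ | ⟨h1, h2, h3⟩
  · have h3 := φ.cut_le_length j'.succ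
    have h4 := h1.2
    have h5 : p < ((z₁ ++ w ++ z₂).map Prod.snd).length := by
      rw [List.length_map] at h3 ⊢
      omega
    rw [List.getElem?_append_left (by omega), List.getElem?_append_left h5]
    change ψ.sourcePos p j = _ at h2
    rw [h2]
    exact hφ j' p h1
  · change ψ.sourcePos p j = _ at h3
    simp only [List.length_map, hfst, List.length_append, List.length_singleton] at h1 h2 h3
    -- the copy does not overlap its source
    rw [Nat.mod_eq_of_lt (by omega)] at h3
    rw [h3]
    obtain ⟨r, rfl⟩ := Nat.exists_eq_add_of_le h1
    rw [Nat.add_sub_cancel_left]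
    have hr : r < w.length := by omega
    have e1 : ((z₁ ++ w ++ z₂).map Prod.snd ++ (raise w ++ [(x, 0)]).map Prod.snd)[
        z₁.length + r]? = some w[r].2 := by
      rw [List.getElem?_append_left (by simp; omega), List.map_append, List.map_append,
        List.getElem?_append_left (by simp; omega), List.getElem?_append_right (by simp)]
      simp [hr]
    have e2 : ((z₁ ++ w ++ z₂).map Prod.snd ++ (raise w ++ [(x, 0)]).map Prod.snd)[
        z₁.length + w.length + z₂.length + r]? = some (w[r].2 + 1) := by
      rw [List.getElem?_append_right (by simp; omega), List.getElem?_map, raise,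
        List.getElem?_append_left (by simp; omega)]
      have e : z₁.length + w.length + z₂.length + r -
          ((z₁ ++ w ++ z₂).map Prod.snd).length = r := by simp; omega
      simp only [e]
      simp [hr]
    rw [e1, e2]
    exact le_rfl

theorem append_singleton (h : HasParsing z t) (x : A) : HasParsing (z ++ [(x, 0)]) (t + 1) := by
  simpa [raise] using h.append (w := []) (List.nil_infix) x

/-- Append blocks one after the other, where each can be appended to every extension of `z`. -/
theorem flatMap {ι : Type*} (h : HasParsing z t) {l : List ι} {f : ι → List (A × ℕ)} {g : ι → ℕ}
    (hf : ∀ i ∈ l, ∀ z' t', z <+: z' → HasParsing z' t' → HasParsing (z' ++ f i) (t' + g i)) :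
    HasParsing (z ++ l.flatMap f) (t + (l.map g).sum) := by
  suffices ∀ z' t', z <+: z' → HasParsing z' t' →
      HasParsing (z' ++ l.flatMap f) (t' + (l.map g).sum) from this z t List.prefix_rfl h
  induction l with
  | nil => intro z' t' _ h'; simpa using h'
  | cons i l ih =>
    intro z' t' hz' h'
    rw [List.flatMap_cons, List.map_cons, List.sum_cons, ← List.append_assoc, ← add_assoc]
    exact ih (fun i hi => hf i (List.mem_cons_of_mem _ hi)) _ _
      (hz'.trans (List.prefix_append _ _)) (hf i List.mem_cons_self z' t' hz' h')

theorem exists_isBLZ {z : List (A × ℕ)} {c : ℕ} (h : HasParsing z t)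
    (hc : ∀ x ∈ z, x.2 ≤ c) : ∃ φ : LZParsing (z.map Prod.fst), φ.IsBLZ c ∧ φ.size = t := by
  obtain ⟨φ, rfl, hφ⟩ := h
  refine ⟨φ, Finset.sup_le fun p hp => ?_, rfl⟩
  rw [Finset.mem_range, List.length_map] at hp
  refine (LZParsing.hop_le_of_source (f := fun p => ((z.map Prod.snd)[p]?).getD 0) hφ p).trans ?_
  simpa [hp] using hc _ (List.getElem_mem hp)

end HasParsing

namespace GraphNumbering

variable {V : Type*} {G : SimpleGraph V} {n m : ℕ} (N : GraphNumbering G n m) (ℓ : ℕ)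
  (C : Finset (Fin n))

/-- `P` with hop-numbers: every letter is a phrase. -/
def hopP (n m ℓ : ℕ) : List (Letter n m ℓ × ℕ) :=
  (List.finRange n).flatMap (fun i => [(.vert i, 0), (.sepP (Fin.castAdd m i), 0)]) ++
    (List.finRange m).flatMap (fun j => [(.edge j, 0), (.sepP (Fin.natAdd n j), 0)])

/-- `X` with hop-numbers: `v_i' | v_i | #` if `v_i` is in `C` and `v_i' | v_i #` otherwise. -/
def hopX (m ℓ : ℕ) (C : Finset (Fin n)) : List (Letter n m ℓ × ℕ) :=
  (List.finRange n).flatMap fun i =>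
    [(.vert' i, 0), (.vert i, if i ∈ C then 0 else 1), (.sepV i, 0)]

/-- `Y` with hop-numbers: `v_p' v_p e | $ | v_q' v_q | e $ #` if `v_p` is in `C` and
`v_p' v_p | e $ | v_q' v_q e | $ #` otherwise. -/
def hopY (N : GraphNumbering G n m) (ℓ : ℕ) (C : Finset (Fin n)) : List (Letter n m ℓ × ℕ) :=
  (List.finRange m).flatMap fun j =>
    if N.fst j ∈ C then
      [(.vert' (N.fst j), 1), (.vert (N.fst j), 1), (.edge j, 0), (.dollar j, 0),
        (.vert' (N.snd j), 1), (.vert (N.snd j), 0), (.edge j, 1), (.dollar j, 1), (.sepE j, 0)]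
    else
      [(.vert' (N.fst j), 1), (.vert (N.fst j), 0), (.edge j, 1), (.dollar j, 0),
        (.vert' (N.snd j), 1), (.vert (N.snd j), 1), (.edge j, 0), (.dollar j, 1), (.sepE j, 0)]

/-- `α^(i)` with hop-numbers (the value at `i = 0` is not used); each copy in `β^(i)` forms one
phrase with its separator. -/
def hopAlpha (N : GraphNumbering G n m) (ℓ : ℕ) (C : Finset (Fin n)) :
    ℕ → List (Letter n m ℓ × ℕ)
  | 0 => []
  | 1 => hopP n m ℓ ++ hopX m ℓ C ++ N.hopY ℓ C
  | i + 2 => N.hopAlpha ℓ C (i + 1) ++ (List.finRange ℓ).flatMap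
      (fun γ => HasParsing.raise (N.hopAlpha ℓ C (i + 1)) ++ [(.sepB (i + 1) γ, 0)])

theorem map_fst_hopAlpha (i : ℕ) : (N.hopAlpha ℓ C i).map Prod.fst = N.strAlpha ℓ i := by
  induction i using hopAlpha.induct with
  | case1 => rfl
  | case2 =>
    simp only [hopAlpha, hopP, hopX, hopY, strAlpha, strP, strX, strY, List.map_append,
      List.map_flatMap, List.map_cons, List.map_nil]
    congr 2
    funext j
    split_ifs <;> rfl
  | case3 i ih =>
    simp only [hopAlpha, strAlpha, strBeta, List.map_append, List.map_flatMap, HasParsing.raise,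
      List.map_map, Function.comp_def, ih, List.map_cons, List.map_nil]

theorem hopAlpha_le (i : ℕ) : ∀ x ∈ N.hopAlpha ℓ C i, x.2 ≤ i := by
  induction i using hopAlpha.induct with
  | case1 => simp [hopAlpha]
  | case2 =>
    intro x hx
    simp only [hopAlpha, hopP, hopX, hopY, List.mem_append, List.mem_flatMap, List.mem_finRange,
      true_and] at hx
    rcases hx with ((⟨_, hx⟩ | ⟨_, hx⟩) | ⟨_, hx⟩) | ⟨_, hx⟩
    · simp only [List.mem_cons, List.not_mem_nil, or_false] at hx
      rcases hx with rfl | rfl <;> simp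
    · simp only [List.mem_cons, List.not_mem_nil, or_false] at hx
      rcases hx with rfl | rfl <;> simp
    · simp only [List.mem_cons, List.not_mem_nil, or_false] at hx
      rcases hx with rfl | rfl | rfl
      · simp
      · dsimp only
        split_ifs <;> simp
      · simp
    · split_ifs at hx <;> simp only [List.mem_cons, List.not_mem_nil, or_false] at hx <;>
        rcases hx with rfl | rfl | rfl | rfl | rfl | rfl | rfl | rfl | rfl <;> simp
  | case3 i ih =>
    intro x hx
    simp only [hopAlpha, HasParsing.raise, List.mem_append, List.mem_flatMap, List.mem_finRange,
      true_and, List.mem_map, List.mem_singleton] at hx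
    rcases hx with hx | ⟨γ, ⟨y, hy, rfl⟩ | rfl⟩
    · exact (ih x hx).trans (Nat.le_succ _)
    · exact Nat.succ_le_succ (ih y hy)
    · exact Nat.zero_le _

variable {ℓ}

theorem hasParsing_hopP : HasParsing (hopP n m ℓ) (2 * n + 2 * m) := by
  have h1 : HasParsing ([] ++ (List.finRange n).flatMap
      (fun i => [(Letter.vert (m := m) (ℓ := ℓ) i, 0), (.sepP (Fin.castAdd m i), 0)]))
      (0 + ((List.finRange n).map fun _ => 2).sum) := by
    refine HasParsing.nil.flatMap fun i _ z' t' _ h => ?_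
    simpa using (h.append_singleton (.vert i)).append_singleton (.sepP (Fin.castAdd m i))
  have h2 := h1.flatMap (l := List.finRange m)
    (f := fun j => [(.edge j, 0), (.sepP (Fin.natAdd n j), 0)]) (g := fun _ => 2)
    fun j _ z' t' _ h => by
      simpa using (h.append_singleton (.edge j)).append_singleton (.sepP (Fin.natAdd n j))
  have e : 2 * n + 2 * m = 0 + ((List.finRange n).map fun _ => 2).sum +
      ((List.finRange m).map fun _ => 2).sum := by
    simp
    omega
  rw [e]
  exact h2

theorem hasParsing_hopX :
    HasParsing (hopP n m ℓ ++ hopX m ℓ C) (2 * n + 2 * m + (2 * n + C.card)) := by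
  have hsum : 2 * n + C.card =
      ((List.finRange n).map fun i => if i ∈ C then 3 else 2).sum := by
    rw [← Fin.sum_univ_def]
    have : ∀ i : Fin n, (if i ∈ C then 3 else 2) = 2 + if i ∈ C then 1 else 0 := by
      intro i
      split_ifs <;> rfl
    simp [this, Finset.sum_add_distrib, mul_comm]
  rw [hsum]
  refine hasParsing_hopP.flatMap fun i _ z' t' hz' h => ?_
  have h1 := h.append_singleton (.vert' i)
  split_ifs
  · simpa using (h1.append_singleton (.vert i)).append_singleton (.sepV i)
  · have hv : [(Letter.vert i, 0)] <:+: hopP n m ℓ :=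
      (List.singleton_infix_iff _ _).2 (by simp [hopP])
    simpa [HasParsing.raise] using
      h1.append (hv.trans (hz'.trans (List.prefix_append _ _)).isInfix) (.sepV i)

theorem hasParsing_hopY (hC : ∀ j, N.fst j ∈ C ∨ N.snd j ∈ C) :
    HasParsing (hopP n m ℓ ++ hopX m ℓ C ++ N.hopY ℓ C)
      (2 * n + 2 * m + (2 * n + C.card) + 4 * m) := by
  have hsum : 4 * m = ((List.finRange m).map fun _ => 4).sum := by simp [mul_comm]
  rw [hsum]
  refine (hasParsing_hopX C).flatMap fun j _ z' t' hz' h => ?_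
  have hX : hopX m ℓ C <:+: z' := (List.suffix_append _ _).isInfix.trans hz'.isInfix
  have hv' : ∀ i, [(Letter.vert' i, 0)] <:+: z' := fun i =>
    ((List.singleton_infix_iff _ _).2 (by simp [hopX])).trans hX
  have hv : ∀ i ∈ C, [(Letter.vert' i, 0), (.vert i, 0)] <:+: z' := fun i hi => by
    refine List.IsInfix.trans ?_ hX
    obtain ⟨l₁, l₂, hl⟩ := List.append_of_mem (List.mem_finRange i)
    rw [hopX, hl, List.flatMap_append, List.flatMap_cons, if_pos hi]
    exact ⟨_, (.sepV i, 0) :: _, by rw [List.append_assoc]; rfl⟩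
  have he : [(Letter.edge j, 0)] <:+: z' :=
    ((List.singleton_infix_iff _ _).2 (by simp [hopP])).trans
      ((List.prefix_append _ _).trans hz').isInfix
  split_ifs with hj
  · have h1 := h.append (hv _ hj) (.edge j)
    have h2 := h1.append_singleton (.dollar j)
    have h3 := h2.append (w := [(.vert' (N.snd j), 0)])
      ((hv' _).trans ((List.prefix_append _ _).trans (List.prefix_append _ _)).isInfix)
      (.vert (N.snd j))
    have h4 := h3.append (w := [(.edge j, 0), (.dollar j, 0)])
      ⟨z' ++ HasParsing.raise [(.vert' (N.fst j), 0), (.vert (N.fst j), 0)],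
        [(.vert' (N.snd j), 1), (.vert (N.snd j), 0)], by simp [HasParsing.raise]⟩ (.sepE j)
    simpa [HasParsing.raise] using h4
  · have hq : N.snd j ∈ C := (hC j).resolve_left hj
    have h1 := h.append (hv' (N.fst j)) (.vert (N.fst j))
    have h2 := h1.append (w := [(.edge j, 0)]) (he.trans (List.prefix_append _ _).isInfix)
      (.dollar j)
    have h3 := h2.append
      ((hv _ hq).trans ((List.prefix_append _ _).trans (List.prefix_append _ _)).isInfix) (.edge j)
    have h4 := h3.append (w := [(.dollar j, 0)])
      ⟨z' ++ [(.vert' (N.fst j), 1), (.vert (N.fst j), 0), (.edge j, 1)],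
        [(.vert' (N.snd j), 1), (.vert (N.snd j), 1), (.edge j, 0)],
        by simp [HasParsing.raise]⟩ (.sepE j)
    simpa [HasParsing.raise] using h4

theorem hasParsing_hopAlpha (hC : ∀ j, N.fst j ∈ C ∨ N.snd j ∈ C) {c : ℕ} (hc : 1 ≤ c) :
    HasParsing (N.hopAlpha ℓ C c) (4 * n + 6 * m + C.card + ℓ * (c - 1)) := by
  induction c, hc using Nat.le_induction with
  | base =>
    have e : 4 * n + 6 * m + C.card + ℓ * (1 - 1) =
        2 * n + 2 * m + (2 * n + C.card) + 4 * m := by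
      simp only [Nat.sub_self, mul_zero]
      omega
    rw [e]
    exact N.hasParsing_hopY C hC
  | succ c hc ih =>
    obtain ⟨c, rfl⟩ : ∃ e, c = e + 1 := ⟨c - 1, by omega⟩
    have h := ih.flatMap (l := List.finRange ℓ) (g := fun _ => 1)
      (f := fun γ => HasParsing.raise (N.hopAlpha ℓ C (c + 1)) ++ [(.sepB (c + 1) γ, 0)])
      fun γ _ z' t' hz' h => h.append hz'.isInfix _
    have e : 4 * n + 6 * m + C.card + ℓ * (c + 1 + 1 - 1) =
        4 * n + 6 * m + C.card + ℓ * (c + 1 - 1) +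
          ((List.finRange ℓ).map fun _ => 1).sum := by
      simp [Nat.mul_succ, add_assoc]
    rw [e]
    exact h

end GraphNumbering

theorem mainTheorem3 {V : Type*} [Finite V] (G : SimpleGraph V) (n m : ℕ)
    (hn : Nat.card V = n) (hm : Nat.card G.edgeSet = m) (N : GraphNumbering G n m)
    (c k ℓ : ℕ) (hc : 1 ≤ c) (hk : k ≤ n) (hℓ : k < ℓ) :
    (∃ C : Finset V, G.IsVertexCover (C : Set V) ∧ C.card = k) ↔
      ∃ φ : LZParsing (N.strAlpha ℓ c), φ.IsBLZ c ∧
        φ.size = 4 * n + 6 * m + k + ℓ * (c - 1) := by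
  classical
  constructor
  · rintro ⟨C, hC, rfl⟩
    have hC' : ∀ j, N.fst j ∈ C.map N.vert.symm.toEmbedding ∨
        N.snd j ∈ C.map N.vert.symm.toEmbedding := by
      intro j
      have h := (N.edge j).2
      rw [N.edge_eq, SimpleGraph.mem_edgeSet] at h
      simpa using hC h
    have h := N.hasParsing_hopAlpha (ℓ := ℓ) _ hC' hc
    rw [Finset.card_map] at h
    have h' := h.exists_isBLZ (N.hopAlpha_le ℓ _ c)
    rwa [N.map_fst_hopAlpha] at h'
  · rintro ⟨φ, hφ, hsize⟩
    rcases Nat.eq_zero_or_pos n with rfl | hpos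
    · -- without vertices the string is made of separators only, and the empty set is a cover
      obtain rfl : k = 0 := by omega
      have : IsEmpty V := Finite.card_eq_zero_iff.1 hn
      exact ⟨∅, fun v => isEmptyElim v, rfl⟩
    · obtain ⟨C, hCk, hC⟩ := N.exists_cover_of_parsing hpos hc hℓ φ hφ hsize.le
      obtain ⟨D, hCD, -, hD⟩ := Finset.exists_subsuperset_card_eq (Finset.subset_univ C) hCk
        (by simpa using hk)
      refine ⟨D.map N.vert.toEmbedding, fun v w hvw => ?_, by rw [Finset.card_map, hD]⟩
      obtain ⟨j, hj⟩ := N.edge.surjective ⟨s(v, w), hvw⟩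
      have h := N.edge_eq j
      rw [hj] at h
      have hcov := (hC j).imp (@hCD _) (@hCD _)
      rcases Sym2.eq_iff.1 h with ⟨rfl, rfl⟩ | ⟨rfl, rfl⟩
      · simpa using hcov
      · simpa using hcov.symm
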